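/- Let $D\subset\mathbb R^3$ be a nonempty bounded set and $B\subset\mathbb R^3$ a nonempty open set with $\overline B\cap\overline D=\emptyset$, and put $\operatorname{dist}(D,B)=\inf_{x\in D,\,y\in B}|x-y|$. Let $f\in L^2(\mathbb R^3)$ be real-valued with $\operatorname{supp} f\subset\overline B$, and suppose there is a constant $c_1>0$ such that either $f\ge c_1$ a.e. on $B$ or $-f\ge c_1$ a.e. on $B$. For $x,n\in\mathbb R^3$ with $|n|=1$, $h>0$ and $0<\theta<\pi$ let $C(x,n,h,\theta)=\{y\in\mathbb R^3 : |y-x|\le h,\ (y-x)\cdot n\ge|y-x|\cos\theta\}$. A set $S\subset\mathbb R^3$ satisfies condition (C) if for every $x\in\partial S$ there is a cone $C(x,n,h,\theta)$ with $C(x,n,h,\theta)\setminus\{x\}\subset S$. The set $D$ has $C^1$ boundary if every $x\in\partial D$ has an open neighbourhood $U$ and a $C^1$ function $\varphi:U\to\mathbb R$ with $\nabla\varphi(x)\ne0$ and $\{\varphi<0\}\subset D\cap U\subset\{\varphi\le0\}$. Suppose that either (a) $D$ has $C^1$ boundary and $B$ satisfies condition (C), or (b) $D$ and $B$ satisfy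 condition (C) and $B$ is convex. Then there is a constant $C>0$ (independent of $\tau$) such that for every $\tau\ge1$ the equation $$(\Delta-\tau^2)v+f=0\quad\text{in }\mathbb R^3$$ has a weak solution $v=v(\cdot;\tau)\in H^1(\mathbb R^3)$, and every such solution satisfies $$C^{-1}\tau^{-7}e^{-2\tau\operatorname{dist}(D,B)}\le\|\nabla v(\cdot;\tau)\|_{L^2(D)}^2\le C\tau^2e^{-2\tau\operatorname{dist}(D,B)}.$$ -/

import Mathlib

open MeasureTheory
open scoped ContDiff

noncomputable section

/-- Euclidean three-space. -/
abbrev E3 : Type := EuclideanSpace ℝ (Fin 3)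

/-- `dist(D, B) = inf {|x - y| : x ∈ D, y ∈ B}`. -/
def setDist (D B : Set E3) : ℝ :=
  sInf {r : ℝ | ∃ x ∈ D, ∃ y ∈ B, r = ‖x - y‖}

/-- The closed truncated cone with vertex `x`, direction `n`, radius `h` and opening angle `θ`. -/
def closedCone (x n : E3) (h θ : ℝ) : Set E3 :=
  {y : E3 | ‖y - x‖ ≤ h ∧ ‖y - x‖ * Real.cos θ ≤ inner ℝ (y - x) n}

/-- Condition (C): every boundary point of `S` is the vertex of a nondegenerate cone which,
apart from its vertex, lies in `S`. -/
def ConeCondition (S : Set E3) : Prop :=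
  ∀ x ∈ frontier S, ∃ (n : E3) (h θ : ℝ), ‖n‖ = 1 ∧ 0 < h ∧ 0 < θ ∧ θ < Real.pi ∧
    closedCone x n h θ \ {x} ⊆ S

/-- `S` has `C^1` boundary: near each boundary point there is a `C^1` function `φ` with nonzero
differential at that point such that `S` lies between `{φ < 0}` and `{φ ≤ 0}`. For open `S` this
says that `S` is locally `{φ < 0}`; the two inclusions leave it open which boundary points belong
to `S`. -/
def HasC1Boundary (S : Set E3) : Prop :=
  ∀ x ∈ frontier S, ∃ (U : Set E3) (φ : E3 → ℝ), IsOpen U ∧ x ∈ U ∧ ContDiffOn ℝ 1 φ U ∧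
    fderiv ℝ φ x ≠ 0 ∧ (∀ y ∈ U, φ y < 0 → y ∈ S) ∧ (∀ y ∈ U, y ∈ S → φ y ≤ 0)

/-- The emission condition on `B`: `f ∈ L²`, `supp f ⊆ closure B`, and `f` or `-f` is bounded
below on `B` by a positive constant. -/
def EmissionCondition (B : Set E3) (f : E3 → ℝ) : Prop :=
  MemLp f 2 volume ∧ (∀ᵐ x : E3, x ∉ closure B → f x = 0) ∧
    ∃ c : ℝ, 0 < c ∧ ((∀ᵐ x : E3, x ∈ B → c ≤ f x) ∨ (∀ᵐ x : E3, x ∈ B → c ≤ -f x))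

/-- `G` is the weak (distributional) gradient of `v` on `ℝ³`. -/
def IsWeakGradient (v : E3 → ℝ) (G : E3 → E3) : Prop :=
  ∀ φ : E3 → ℝ, ContDiff ℝ ∞ φ → HasCompactSupport φ → ∀ e : E3,
    ∫ x, v x * fderiv ℝ φ x e = -∫ x, inner ℝ (G x) e * φ x

/-- `v` is an `H¹(ℝ³)` function with weak gradient `G`, and it solves
`(Δ - τ²) v + f = 0` in `ℝ³` in the weak sense. -/
structure IsWeakSolution (τ : ℝ) (f v : E3 → ℝ) (G : E3 → E3) : Prop where
  memLp : MemLp v 2 volume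
  memLp_grad : MemLp G 2 volume
  weakGradient : IsWeakGradient v G
  equation : ∀ φ : E3 → ℝ, ContDiff ℝ ∞ φ → HasCompactSupport φ →
    (∫ x, inner ℝ (G x) (gradient φ x)) + τ ^ 2 * (∫ x, v x * φ x) = ∫ x, f x * φ x

end

/-!
Cut the Yukawa potential `e^{-τ|x - a|} / |x - a|` off inside a ball `B(a, ε)`. The image of the
truncated potential under `τ² - Δ` is a smooth source supported in `B(a, ε)`, so testing the
equation and its first derivatives with the truncated potential expresses local averages of `v` and
`∇v` near `a` through integrals of `f` against the potential and its gradient, of size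
`e^{-τ|x - a|}` on the support of `f`.

For the upper bound, `a` runs through the Lebesgue points of `∇v` in `closure D` and `ε → 0`, which
gives `|∇v(a)| ≤ M τ e^{-τ dist(D, B)}`.

For the lower bound, let `p ∈ closure D` and `q ∈ closure B` realise the distance. Cone and `C¹`
boundary conditions both provide balls of radius comparable to `1 / τ` in `D` and in `B`, within
`O(1 / τ)` of `p` and `q`. With `a` the centre and `ε` the radius of the first, the source lies
in `D`, where `f = 0`, so the equation tested with the source itself identifies `∫ ∇v · ∇(source)`
with `-τ² ∫ f (potential)`. The second ball alone makes `∫ f (potential)` at least of order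
`τ⁻³ e^{-τ dist(D, B)}`, and Cauchy–Schwarz on `B(a, ε)` turns this into a lower bound for
`∫_D |∇v|²`.
-/

open Filter Topology InnerProductSpace Laplacian

/-! ### Directional derivatives and the Laplacian -/

section DirDeriv

variable {E : Type*} [NormedAddCommGroup E] [NormedSpace ℝ E] {φ ψ : E → ℝ}

/-- The derivative of `φ` in direction `e`, as a function of the base point, so that directional
derivatives can be iterated. -/
noncomputable def dirDeriv (e : E) (φ : E → ℝ) : E → ℝ := fun x => fderiv ℝ φ x e

theorem contDiff_dirDeriv {m n : ℕ∞ω} (hφ : ContDiff ℝ n φ) (hmn : m + 1 ≤ n) (e : E) :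
    ContDiff ℝ m (dirDeriv e φ) :=
  (hφ.fderiv_right hmn).clm_apply contDiff_const

theorem dirDeriv_add (hφ : Differentiable ℝ φ) (hψ : Differentiable ℝ ψ) (e : E) :
    dirDeriv e (fun x => φ x + ψ x) = fun x => dirDeriv e φ x + dirDeriv e ψ x := by
  ext x
  simp [dirDeriv, fderiv_fun_add (hφ x) (hψ x)]

theorem dirDeriv_const_mul (hφ : Differentiable ℝ φ) (c : ℝ) (e : E) :
    dirDeriv e (fun x => c * φ x) = fun x => c * dirDeriv e φ x := by
  ext x
  simp [dirDeriv, fderiv_const_mul (hφ x)]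

theorem dirDeriv_sum {ι : Type*} [Fintype ι] {φ : ι → E → ℝ} (hφ : ∀ i, Differentiable ℝ (φ i))
    (e : E) : dirDeriv e (fun x => ∑ i, φ i x) = fun x => ∑ i, dirDeriv e (φ i) x := by
  ext x
  simp [dirDeriv, fderiv_fun_sum fun i _ => hφ i x]

theorem dirDeriv_mul (hφ : Differentiable ℝ φ) (hψ : Differentiable ℝ ψ) (e : E) :
    dirDeriv e (fun x => φ x * ψ x) = fun x => φ x * dirDeriv e ψ x + dirDeriv e φ x * ψ x := by
  ext x
  simp [dirDeriv, fderiv_fun_mul (hφ x) (hψ x), mul_comm]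

theorem dirDeriv_comp_smul_sub (hφ : Differentiable ℝ φ) (c : ℝ) (a e : E) :
    dirDeriv e (fun x => φ (c • (x - a))) = fun x => c * dirDeriv e φ (c • (x - a)) := by
  ext x
  have haffine : HasFDerivAt (fun x : E => c • (x - a)) (c • ContinuousLinearMap.id ℝ E) x :=
    ((hasFDerivAt_id x).sub_const a).const_smul c
  have hcomp := ((hφ (c • (x - a))).hasFDerivAt.comp x haffine).fderiv
  simp only [Function.comp_def] at hcomp
  simp [dirDeriv, hcomp]

theorem dirDeriv_dirDeriv_apply (hφ : ContDiff ℝ 2 φ) (e e' x : E) :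
    dirDeriv e (dirDeriv e' φ) x = fderiv ℝ (fderiv ℝ φ) x e e' := by
  have hd : DifferentiableAt ℝ (fderiv ℝ φ) x :=
    (hφ.fderiv_right (m := 1) (by norm_num)).differentiable one_ne_zero x
  unfold dirDeriv
  rw [fderiv_clm_apply hd (differentiableAt_const e')]
  simp

theorem dirDeriv_comm (hφ : ContDiff ℝ 2 φ) (e e' : E) :
    dirDeriv e (dirDeriv e' φ) = dirDeriv e' (dirDeriv e φ) := by
  ext x
  rw [dirDeriv_dirDeriv_apply hφ, dirDeriv_dirDeriv_apply hφ]
  exact (hφ.contDiffAt.isSymmSndFDerivAt (by simp)) e e'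

end DirDeriv

section InnerDirDeriv

variable {E : Type*} [NormedAddCommGroup E] [InnerProductSpace ℝ E]

theorem dirDeriv_inner (e e' : E) : dirDeriv e (fun x => inner ℝ x e') = fun _ => inner ℝ e e' := by
  ext x
  have hlinear : (fun x : E => inner ℝ x e') = innerSL ℝ e' := by
    ext y
    simp [real_inner_comm]
  rw [dirDeriv, hlinear, ContinuousLinearMap.fderiv]
  exact real_inner_comm e e'

theorem dirDeriv_comp_norm_sq {g : ℝ → ℝ} (hg : Differentiable ℝ g) (e : E) :
    dirDeriv e (fun x : E => g (‖x‖ ^ 2)) = fun x => 2 * deriv g (‖x‖ ^ 2) * inner ℝ x e := by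
  ext x
  have hcomp := ((hg (‖x‖ ^ 2)).hasDerivAt.comp_hasFDerivAt x
    (hasStrictFDerivAt_norm_sq x).hasFDerivAt).fderiv
  simp only [Function.comp_def] at hcomp
  simp only [dirDeriv, hcomp, smul_apply, coe_innerSL_apply, nsmul_eq_mul, Nat.cast_ofNat,
    smul_eq_mul]
  ring

theorem dirDeriv_dirDeriv_comp_norm_sq {g : ℝ → ℝ} (hg : ContDiff ℝ 2 g) (e : E) :
    dirDeriv e (dirDeriv e fun x : E => g (‖x‖ ^ 2)) = fun x =>
      4 * deriv (deriv g) (‖x‖ ^ 2) * inner ℝ x e ^ 2 + 2 * deriv g (‖x‖ ^ 2) * ‖e‖ ^ 2 := by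
  have hg' : Differentiable ℝ (deriv g) :=
    (hg.iterate_deriv' 1 1).differentiable one_ne_zero
  have hnorm : Differentiable ℝ fun x : E => ‖x‖ ^ 2 :=
    (contDiff_norm_sq ℝ).differentiable two_ne_zero
  have hinner : Differentiable ℝ fun x : E => inner ℝ x e :=
    differentiable_id.inner ℝ (differentiable_const e)
  rw [dirDeriv_comp_norm_sq (hg.differentiable two_ne_zero),
    dirDeriv_mul ((hg'.fun_comp hnorm).const_mul 2) hinner,
    dirDeriv_const_mul (hg'.fun_comp hnorm), dirDeriv_inner, dirDeriv_comp_norm_sq hg']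
  ext x
  simp only [real_inner_self_eq_norm_sq]
  ring

end InnerDirDeriv

section Laplacian

variable {E : Type*} [NormedAddCommGroup E] [InnerProductSpace ℝ E] [FiniteDimensional ℝ E]
  {φ ψ : E → ℝ}

theorem laplacian_eq_sum_dirDeriv {ι : Type*} [Fintype ι] (b : OrthonormalBasis ι ℝ E)
    (hφ : ContDiff ℝ 2 φ) : Δ φ = fun x => ∑ i, dirDeriv (b i) (dirDeriv (b i) φ) x := by
  ext x
  simp [laplacian_eq_iteratedFDeriv_orthonormalBasis φ b, iteratedFDeriv_two_apply,
    dirDeriv_dirDeriv_apply hφ]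

theorem contDiff_laplacian {m n : ℕ∞ω} (hφ : ContDiff ℝ n φ) (hmn : m + 2 ≤ n) :
    ContDiff ℝ m (Δ φ) := by
  rw [laplacian_eq_sum_dirDeriv (stdOrthonormalBasis ℝ E) (hφ.of_le (le_add_self.trans hmn))]
  have hmn' : m + 1 + 1 ≤ n := by rwa [add_assoc, one_add_one_eq_two]
  exact ContDiff.sum fun i _ => contDiff_dirDeriv (contDiff_dirDeriv hφ hmn' _) le_rfl _

theorem laplacian_dirDeriv (hφ : ContDiff ℝ 3 φ) (e : E) :
    Δ (dirDeriv e φ) = dirDeriv e (Δ φ) := by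
  set b := stdOrthonormalBasis ℝ E
  have hφ' (e : E) : ContDiff ℝ 2 (dirDeriv e φ) := contDiff_dirDeriv hφ (by norm_num) e
  have hφ'' (i) : Differentiable ℝ (dirDeriv (b i) (dirDeriv (b i) φ)) :=
    (contDiff_dirDeriv (m := 1) (hφ' _) (by norm_num) _).differentiable one_ne_zero
  rw [laplacian_eq_sum_dirDeriv b (hφ' e),
    laplacian_eq_sum_dirDeriv b (hφ.of_le (by norm_num)), dirDeriv_sum hφ'']
  ext x
  refine Finset.sum_congr rfl fun i _ => ?_
  rw [dirDeriv_comm (hφ.of_le (by norm_num)) (b i) e, dirDeriv_comm (hφ' (b i)) e]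

theorem laplacian_mul {ι : Type*} [Fintype ι] (b : OrthonormalBasis ι ℝ E)
    (hφ : ContDiff ℝ 2 φ) (hψ : ContDiff ℝ 2 ψ) :
    Δ (fun x => φ x * ψ x) = fun x => φ x * Δ ψ x
      + 2 * ∑ i, dirDeriv (b i) φ x * dirDeriv (b i) ψ x + Δ φ x * ψ x := by
  have hd {χ : E → ℝ} (hχ : ContDiff ℝ 2 χ) : Differentiable ℝ χ := hχ.differentiable two_ne_zero
  have hd' {χ : E → ℝ} (hχ : ContDiff ℝ 2 χ) (e : E) : Differentiable ℝ (dirDeriv e χ) :=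
    (contDiff_dirDeriv (m := 1) hχ (by norm_num) e).differentiable one_ne_zero
  have hpure (e : E) : dirDeriv e (dirDeriv e fun x => φ x * ψ x) = fun x =>
      φ x * dirDeriv e (dirDeriv e ψ) x + 2 * (dirDeriv e φ x * dirDeriv e ψ x)
        + dirDeriv e (dirDeriv e φ) x * ψ x := by
    rw [dirDeriv_mul (hd hφ) (hd hψ),
      dirDeriv_add ((hd hφ).fun_mul (hd' hψ e)) ((hd' hφ e).fun_mul (hd hψ)),
      dirDeriv_mul (hd hφ) (hd' hψ e), dirDeriv_mul (hd' hφ e) (hd hψ)]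
    ext x
    ring
  ext x
  simp only [laplacian_eq_sum_dirDeriv b (hφ.mul hψ), laplacian_eq_sum_dirDeriv b hφ,
    laplacian_eq_sum_dirDeriv b hψ, hpure, Finset.sum_add_distrib, Finset.mul_sum, Finset.sum_mul]

theorem laplacian_const_mul (hφ : ContDiff ℝ 2 φ) (c : ℝ) :
    Δ (fun x => c * φ x) = fun x => c * Δ φ x :=
  funext fun _ => laplacian_smul c hφ.contDiffAt

theorem laplacian_comp_smul_sub (hφ : ContDiff ℝ 2 φ) (c : ℝ) (a : E) :
    Δ (fun x => φ (c • (x - a))) = fun x => c ^ 2 * Δ φ (c • (x - a)) := by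
  set b := stdOrthonormalBasis ℝ E
  have hφ' (i) : Differentiable ℝ (dirDeriv (b i) φ) :=
    (contDiff_dirDeriv (m := 1) hφ (by norm_num) _).differentiable one_ne_zero
  have haffine : Differentiable ℝ fun x : E => c • (x - a) := by fun_prop
  ext x
  rw [laplacian_eq_sum_dirDeriv b (by fun_prop), laplacian_eq_sum_dirDeriv b hφ]
  simp only [Finset.mul_sum]
  refine Finset.sum_congr rfl fun i _ => ?_
  rw [dirDeriv_comp_smul_sub (hφ.differentiable two_ne_zero),
    dirDeriv_const_mul ((hφ' i).fun_comp haffine), dirDeriv_comp_smul_sub (hφ' i)]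
  ring

theorem laplacian_comp_norm_sq {g : ℝ → ℝ} (hg : ContDiff ℝ 2 g) :
    Δ (fun x : E => g (‖x‖ ^ 2)) = fun x =>
      4 * ‖x‖ ^ 2 * deriv (deriv g) (‖x‖ ^ 2) + 2 * Module.finrank ℝ E * deriv g (‖x‖ ^ 2) := by
  set b := stdOrthonormalBasis ℝ E
  ext x
  have hparseval : ∑ i, inner ℝ x (b i) ^ 2 = ‖x‖ ^ 2 := by
    simpa using b.sum_sq_norm_inner_left x
  have hcomp : ContDiff ℝ 2 fun x : E => g (‖x‖ ^ 2) := hg.comp (contDiff_norm_sq ℝ)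
  simp only [laplacian_eq_sum_dirDeriv b hcomp, dirDeriv_dirDeriv_comp_norm_sq hg,
    Finset.sum_add_distrib, ← Finset.mul_sum, hparseval, b.norm_eq_one]
  simp only [one_pow, Finset.sum_const, Finset.card_univ, Fintype.card_fin, nsmul_eq_mul, mul_one]
  ring

end Laplacian

/-! ### Test functions and cutoffs -/

/-- Smooth functions with compact support, against which weak equations are tested. -/
structure IsTestFunction {E : Type*} [NormedAddCommGroup E] [NormedSpace ℝ E] (φ : E → ℝ) :
    Prop where
  contDiff : ContDiff ℝ ∞ φ
  hasCompactSupport : HasCompactSupport φ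

namespace IsTestFunction

section Normed

variable {E : Type*} [NormedAddCommGroup E] [NormedSpace ℝ E] {φ ψ : E → ℝ}

theorem mul_right (hφ : IsTestFunction φ) (hψ : ContDiff ℝ ∞ ψ) :
    IsTestFunction fun x => φ x * ψ x :=
  ⟨hφ.contDiff.mul hψ, hφ.hasCompactSupport.mul_right⟩

theorem dirDeriv (hφ : IsTestFunction φ) (e : E) : IsTestFunction (dirDeriv e φ) :=
  ⟨contDiff_dirDeriv hφ.contDiff le_rfl e, hφ.hasCompactSupport.fderiv_apply (𝕜 := ℝ) e⟩

theorem comp_smul (hφ : IsTestFunction φ) {c : ℝ} (hc : c ≠ 0) :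
    IsTestFunction fun x => φ (c • x) :=
  ⟨hφ.contDiff.comp (contDiff_id.const_smul c), hφ.hasCompactSupport.comp_smul hc⟩

theorem differentiable (hφ : IsTestFunction φ) : Differentiable ℝ φ :=
  hφ.contDiff.differentiable (by simp)

theorem exists_bound (hφ : IsTestFunction φ) : ∃ C, ∀ x, ‖φ x‖ ≤ C :=
  hφ.hasCompactSupport.exists_bound_of_continuous hφ.contDiff.continuous

theorem memLp [MeasurableSpace E] [OpensMeasurableSpace E] [SecondCountableTopology E]
    (hφ : IsTestFunction φ) (p : ENNReal) (μ : Measure E) [IsFiniteMeasureOnCompacts μ] :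
    MemLp φ p μ :=
  hφ.contDiff.continuous.memLp_of_hasCompactSupport hφ.hasCompactSupport

theorem memLp_smul_const [MeasurableSpace E] [OpensMeasurableSpace E] [SecondCountableTopology E]
    (hφ : IsTestFunction φ) (e : E) (p : ENNReal) (μ : Measure E) [IsFiniteMeasureOnCompacts μ] :
    MemLp (fun x => φ x • e) p μ :=
  (hφ.contDiff.continuous.smul continuous_const).memLp_of_hasCompactSupport
    hφ.hasCompactSupport.smul_right

theorem integrable_mul [MeasurableSpace E] [OpensMeasurableSpace E]
    {μ : Measure E} [IsFiniteMeasureOnCompacts μ] (hφ : IsTestFunction φ) (hψ : Continuous ψ) :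
    Integrable (fun x => φ x * ψ x) μ :=
  (hφ.contDiff.continuous.mul hψ).integrable_of_hasCompactSupport hφ.hasCompactSupport.mul_right

theorem integral_mul_dirDeriv [FiniteDimensional ℝ E] [MeasurableSpace E] [BorelSpace E]
    {μ : Measure E} [μ.IsAddHaarMeasure] (hφ : IsTestFunction φ) (hψ : ContDiff ℝ 1 ψ) (e : E) :
    ∫ x, φ x * _root_.dirDeriv e ψ x ∂μ = -∫ x, _root_.dirDeriv e φ x * ψ x ∂μ := by
  have hψ' : Continuous (_root_.dirDeriv e ψ) :=
    (contDiff_dirDeriv (m := 0) hψ (by simp) e).continuous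
  exact integral_mul_fderiv_eq_neg_fderiv_mul_of_integrable
    ((hφ.dirDeriv e).integrable_mul hψ.continuous) (hφ.integrable_mul hψ')
    (hφ.integrable_mul hψ.continuous)
    (fun x _ => hφ.differentiable x) fun x _ => hψ.differentiable one_ne_zero x

end Normed

section Inner

variable {E : Type*} [NormedAddCommGroup E] [InnerProductSpace ℝ E] [FiniteDimensional ℝ E]
  {φ ψ : E → ℝ}

theorem laplacian (hφ : IsTestFunction φ) : IsTestFunction (Δ φ) := by
  refine ⟨contDiff_laplacian hφ.contDiff le_rfl, ?_⟩
  refine hφ.hasCompactSupport.mono' fun x hx => ?_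
  contrapose! hx
  have hzero : φ =ᶠ[𝓝 x] fun _ => 0 := notMem_tsupport_iff_eventuallyEq.1 hx
  simp [(laplacian_congr_nhds hzero).eq_of_nhds]

theorem gradient_memLp [MeasurableSpace E] [BorelSpace E] (hφ : IsTestFunction φ) (p : ENNReal)
    (μ : Measure E) [IsFiniteMeasureOnCompacts μ] : MemLp (gradient φ) p μ :=
  ((LinearIsometryEquiv.continuous _).comp
    (hφ.contDiff.continuous_fderiv (by simp))).memLp_of_hasCompactSupport
      ((hφ.hasCompactSupport.fderiv (𝕜 := ℝ)).comp_left (map_zero _))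

theorem integral_mul_laplacian [MeasurableSpace E] [BorelSpace E] {μ : Measure E}
    [μ.IsAddHaarMeasure] (hφ : IsTestFunction φ) (hψ : ContDiff ℝ 2 ψ) :
    ∫ x, φ x * Δ ψ x ∂μ = ∫ x, Δ φ x * ψ x ∂μ := by
  set b := stdOrthonormalBasis ℝ E
  have hφ' (i) : IsTestFunction (_root_.dirDeriv (b i) (_root_.dirDeriv (b i) φ)) :=
    (hφ.dirDeriv _).dirDeriv _
  have hψ' (i) : ContDiff ℝ 1 (_root_.dirDeriv (b i) ψ) := contDiff_dirDeriv hψ (by norm_num) _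
  have hψ'' (i) : Continuous (_root_.dirDeriv (b i) (_root_.dirDeriv (b i) ψ)) :=
    (contDiff_dirDeriv (m := 0) (hψ' i) (by simp) _).continuous
  rw [laplacian_eq_sum_dirDeriv b hψ,
    laplacian_eq_sum_dirDeriv b (hφ.contDiff.of_le ENat.LEInfty.out)]
  simp only [Finset.mul_sum, Finset.sum_mul]
  rw [integral_finsetSum _ fun i _ => hφ.integrable_mul (hψ'' i),
    integral_finsetSum _ fun i _ => (hφ' i).integrable_mul hψ.continuous]
  refine Finset.sum_congr rfl fun i _ => ?_
  rw [hφ.integral_mul_dirDeriv (hψ' i),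
    (hφ.dirDeriv _).integral_mul_dirDeriv (hψ.of_le one_le_two), neg_neg]

end Inner

end IsTestFunction

section Cutoff

/-- The multipliers `m n` are continuous, uniformly bounded, and converge pointwise to the constant
`c`: this is what dominated convergence needs to pass to the limit in `∫ m n * g`. -/
structure BoundedlyTendsto {X : Type*} [TopologicalSpace X] (m : ℕ → X → ℝ) (c : ℝ) : Prop where
  continuous : ∀ n, Continuous (m n)
  exists_bound : ∃ C, ∀ n x, ‖m n x‖ ≤ C
  tendsto : ∀ x, Tendsto (fun n => m n x) atTop (𝓝 c)

theorem BoundedlyTendsto.tendsto_integral_mul {X : Type*} [TopologicalSpace X] [MeasurableSpace X]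
    [OpensMeasurableSpace X] [SecondCountableTopology X] {μ : Measure X} {m : ℕ → X → ℝ} {c : ℝ}
    (hm : BoundedlyTendsto m c) {g : X → ℝ} (hg : Integrable g μ) :
    Tendsto (fun n => ∫ x, m n x * g x ∂μ) atTop (𝓝 (c * ∫ x, g x ∂μ)) := by
  obtain ⟨C, hC⟩ := hm.exists_bound
  rw [← integral_const_mul]
  refine tendsto_integral_of_dominated_convergence (fun x => C * ‖g x‖)
    (fun n => (hm.continuous n).aestronglyMeasurable.mul hg.1) (hg.norm.const_mul C)
    (fun n => Eventually.of_forall fun x => ?_)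
    (Eventually.of_forall fun x => (hm.tendsto x).mul_const _)
  rw [norm_mul]
  gcongr
  exact hC n x

/-- Weak convergence in `L²(μ)`: the integrals against every square integrable function
converge. -/
structure WeaklyTendstoL2 {X : Type*} [MeasurableSpace X] (μ : Measure X) (φ' : ℕ → X → ℝ)
    (φ : X → ℝ) : Prop where
  memLp_seq : ∀ n, MemLp (φ' n) 2 μ
  memLp : MemLp φ 2 μ
  tendsto_integral_mul : ∀ w : X → ℝ, MemLp w 2 μ →
    Tendsto (fun n => ∫ x, w x * φ' n x ∂μ) atTop (𝓝 (∫ x, w x * φ x ∂μ))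

section WeaklyTendstoL2

variable {X : Type*} [MeasurableSpace X] {μ : Measure X}

theorem BoundedlyTendsto.weaklyTendstoL2_mul [TopologicalSpace X]
    [OpensMeasurableSpace X] [SecondCountableTopology X] {m : ℕ → X → ℝ} {c : ℝ}
    (hm : BoundedlyTendsto m c) {φ : X → ℝ} (hφ : MemLp φ 2 μ) :
    WeaklyTendstoL2 μ (fun n x => m n x * φ x) fun x => c * φ x where
  memLp_seq n := by
    obtain ⟨C, hC⟩ := hm.exists_bound
    refine hφ.of_le_mul (c := C) ((hm.continuous n).aestronglyMeasurable.mul hφ.1)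
      (Eventually.of_forall fun x => ?_)
    rw [norm_mul]
    gcongr
    exact hC n x
  memLp := hφ.const_mul c
  tendsto_integral_mul w hw := by
    simpa only [Pi.mul_apply, mul_left_comm (w _), integral_const_mul] using
      hm.tendsto_integral_mul (hw.integrable_mul hφ)

theorem WeaklyTendstoL2.add {φ' ψ' : ℕ → X → ℝ} {φ ψ : X → ℝ} (hφ : WeaklyTendstoL2 μ φ' φ)
    (hψ : WeaklyTendstoL2 μ ψ' ψ) :
    WeaklyTendstoL2 μ (fun n x => φ' n x + ψ' n x) fun x => φ x + ψ x where
  memLp_seq n := (hφ.memLp_seq n).add (hψ.memLp_seq n)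
  memLp := hφ.memLp.add hψ.memLp
  tendsto_integral_mul w hw := by
    have hadd {k l : X → ℝ} (hk : MemLp k 2 μ) (hl : MemLp l 2 μ) :
        ∫ x, w x * (k x + l x) ∂μ = ∫ x, w x * k x ∂μ + ∫ x, w x * l x ∂μ := by
      simp only [mul_add]
      exact integral_add (hw.integrable_mul hk) (hw.integrable_mul hl)
    simp only [hadd (hφ.memLp_seq _) (hψ.memLp_seq _), hadd hφ.memLp hψ.memLp]
    exact (hφ.tendsto_integral_mul w hw).add (hψ.tendsto_integral_mul w hw)

theorem WeaklyTendstoL2.sum {ι : Type*} [Fintype ι] {φ' : ι → ℕ → X → ℝ} {φ : ι → X → ℝ}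
    (hφ : ∀ i, WeaklyTendstoL2 μ (φ' i) (φ i)) :
    WeaklyTendstoL2 μ (fun n x => ∑ i, φ' i n x) fun x => ∑ i, φ i x where
  memLp_seq n := memLp_finsetSum _ fun i _ => (hφ i).memLp_seq n
  memLp := memLp_finsetSum _ fun i _ => (hφ i).memLp
  tendsto_integral_mul w hw := by
    have hsum {k : ι → X → ℝ} (hk : ∀ i, MemLp (k i) 2 μ) :
        ∫ x, w x * ∑ i, k i x ∂μ = ∑ i, ∫ x, w x * k i x ∂μ := by
      simp only [Finset.mul_sum]
      exact integral_finsetSum _ fun i _ => hw.integrable_mul (hk i)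
    simp only [hsum fun i => (hφ i).memLp_seq _, hsum fun i => (hφ i).memLp]
    exact tendsto_finsetSum _ fun i _ => (hφ i).tendsto_integral_mul w hw

end WeaklyTendstoL2

variable {E : Type*} [NormedAddCommGroup E]

theorem IsTestFunction.boundedlyTendsto_mul_comp_smul [NormedSpace ℝ E] {ψ : E → ℝ}
    (hψ : IsTestFunction ψ) {a s : ℕ → ℝ} {α : ℝ} (ha : Tendsto a atTop (𝓝 α))
    (hs : Tendsto s atTop (𝓝 0)) :
    BoundedlyTendsto (fun n x => a n * ψ (s n • x)) (α * ψ 0) where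
  continuous n := continuous_const.mul (hψ.contDiff.continuous.comp (continuous_const_smul (s n)))
  exists_bound := by
    obtain ⟨A, hA⟩ := ha.norm.bddAbove_range
    obtain ⟨C, hC⟩ := hψ.exists_bound
    refine ⟨A * C, fun n x => ?_⟩
    rw [norm_mul]
    have haA : ‖a n‖ ≤ A := hA ⟨n, rfl⟩
    exact mul_le_mul haA (hC _) (norm_nonneg _) ((norm_nonneg _).trans haA)
  tendsto x := by
    refine ha.mul ((hψ.contDiff.continuous.tendsto 0).comp ?_)
    simpa using hs.smul_const x

theorem exists_cutoff_sequence [InnerProductSpace ℝ E] [FiniteDimensional ℝ E] :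
    ∃ χ : ℕ → E → ℝ, (∀ n, IsTestFunction (χ n)) ∧ BoundedlyTendsto χ 1 ∧
      (∀ e, BoundedlyTendsto (fun n => dirDeriv e (χ n)) 0) ∧
      BoundedlyTendsto (fun n => Δ (χ n)) 0 := by
  obtain ⟨b, hb, hb0⟩ : ∃ b : E → ℝ, IsTestFunction b ∧ b 0 = 1 := by
    let b : ContDiffBump (0 : E) := ⟨1, 2, one_pos, one_lt_two⟩
    exact ⟨b, ⟨b.contDiff, b.hasCompactSupport⟩,
      b.one_of_mem_closedBall (Metric.mem_closedBall_self zero_le_one)⟩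
  have hs : Tendsto (fun n : ℕ => ((n : ℝ) + 1)⁻¹) atTop (𝓝 0) :=
    tendsto_inv_atTop_zero.comp
      (tendsto_atTop_add_const_right _ _ tendsto_natCast_atTop_atTop)
  have hs_sq : Tendsto (fun n : ℕ => ((n : ℝ) + 1)⁻¹ ^ 2) atTop (𝓝 0) := by
    simpa only [zero_pow two_ne_zero] using hs.pow 2
  have hderiv (n : ℕ) (e : E) : dirDeriv e (fun x => b (((n : ℝ) + 1)⁻¹ • x)) =
      fun x => ((n : ℝ) + 1)⁻¹ * dirDeriv e b (((n : ℝ) + 1)⁻¹ • x) := by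
    simpa using dirDeriv_comp_smul_sub hb.differentiable ((n : ℝ) + 1)⁻¹ 0 e
  have hlaplacian (n : ℕ) : Δ (fun x => b (((n : ℝ) + 1)⁻¹ • x)) =
      fun x => ((n : ℝ) + 1)⁻¹ ^ 2 * Δ b (((n : ℝ) + 1)⁻¹ • x) := by
    simpa using laplacian_comp_smul_sub (hb.contDiff.of_le ENat.LEInfty.out) ((n : ℝ) + 1)⁻¹ 0
  refine ⟨fun n x => b (((n : ℝ) + 1)⁻¹ • x), fun n => hb.comp_smul (by positivity), ?_,
    fun e => ?_, ?_⟩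
  · simpa only [hb0, one_mul] using
      hb.boundedlyTendsto_mul_comp_smul (tendsto_const_nhds (x := (1 : ℝ))) hs
  · simpa only [hderiv, zero_mul] using (hb.dirDeriv e).boundedlyTendsto_mul_comp_smul hs hs
  · simpa only [hlaplacian, zero_mul] using
      hb.laplacian.boundedlyTendsto_mul_comp_smul hs_sq hs

variable [InnerProductSpace ℝ E] [FiniteDimensional ℝ E] [MeasurableSpace E] [BorelSpace E]

theorem integral_laplacian_eq_zero {μ : Measure E} [μ.IsAddHaarMeasure] {φ : E → ℝ}
    (hφ : ContDiff ℝ 2 φ) (hint : Integrable φ μ) (hint' : Integrable (Δ φ) μ) :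
    ∫ x, Δ φ x ∂μ = 0 := by
  obtain ⟨χ, hχ, hχ_one, -, hχ_laplacian⟩ := exists_cutoff_sequence (E := E)
  have hleft := hχ_one.tendsto_integral_mul hint'
  have hright := hχ_laplacian.tendsto_integral_mul hint
  simp only [(hχ _).integral_mul_laplacian hφ, one_mul, zero_mul] at hleft hright
  exact tendsto_nhds_unique hleft hright

/-- Smooth functions which are square integrable together with their first derivatives and their
Laplacian: weak equations for `L²` data extend to these from test functions. -/
structure IsSmoothH2 (μ : Measure E) (φ : E → ℝ) : Prop where
  contDiff : ContDiff ℝ ∞ φ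
  memLp : MemLp φ 2 μ
  memLp_dirDeriv : ∀ e, MemLp (dirDeriv e φ) 2 μ
  memLp_laplacian : MemLp (Δ φ) 2 μ

theorem IsSmoothH2.exists_weakApprox {μ : Measure E} {φ : E → ℝ} (hφ : IsSmoothH2 μ φ) :
    ∃ φ' : ℕ → E → ℝ, (∀ n, IsTestFunction (φ' n)) ∧ WeaklyTendstoL2 μ φ' φ ∧
      (∀ e, WeaklyTendstoL2 μ (fun n => dirDeriv e (φ' n)) (dirDeriv e φ)) ∧
      WeaklyTendstoL2 μ (fun n => Δ (φ' n)) (Δ φ) := by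
  obtain ⟨χ, hχ, hχ_one, hχ_dirDeriv, hχ_laplacian⟩ := exists_cutoff_sequence (E := E)
  set b := stdOrthonormalBasis ℝ E
  refine ⟨fun n x => χ n x * φ x, fun n => (hχ n).mul_right hφ.contDiff, ?_, fun e => ?_, ?_⟩
  · simpa only [one_mul] using hχ_one.weaklyTendstoL2_mul hφ.memLp
  · simpa only [dirDeriv_mul (hχ _).differentiable (hφ.contDiff.differentiable (by simp)),
      one_mul, zero_mul, add_zero] using
      (hχ_one.weaklyTendstoL2_mul (hφ.memLp_dirDeriv e)).add
        ((hχ_dirDeriv e).weaklyTendstoL2_mul hφ.memLp)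
  · have hcross (i) : WeaklyTendstoL2 μ (fun n x => 2 * (dirDeriv (b i) (χ n) x *
        dirDeriv (b i) φ x)) fun _ => 0 := by
      simpa only [mul_zero, zero_mul, ← mul_assoc, mul_comm (2 : ℝ)] using
        (hχ_dirDeriv (b i)).weaklyTendstoL2_mul ((hφ.memLp_dirDeriv (b i)).const_mul 2)
    simpa only [laplacian_mul b ((hχ _).contDiff.of_le ENat.LEInfty.out)
      (hφ.contDiff.of_le ENat.LEInfty.out), Finset.mul_sum, Finset.sum_const_zero,
      one_mul, zero_mul, add_zero] using
      ((hχ_one.weaklyTendstoL2_mul hφ.memLp_laplacian).add (WeaklyTendstoL2.sum hcross)).add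
        (hχ_laplacian.weaklyTendstoL2_mul hφ.memLp)

end Cutoff

/-! ### Existence of weak solutions -/

section Existence

theorem IsTestFunction.isWeakGradient_gradient {φ : E3 → ℝ} (hφ : IsTestFunction φ) :
    IsWeakGradient φ (gradient φ) := fun χ hχ _ e => by
  simpa only [inner_gradient_left, _root_.dirDeriv] using
    hφ.integral_mul_dirDeriv (μ := volume) (hχ.of_le (by simp)) e

theorem IsWeakGradient.congr {v v' : E3 → ℝ} {G G' : E3 → E3} (h : IsWeakGradient v G)
    (hv : v =ᵐ[volume] v') (hG : G =ᵐ[volume] G') : IsWeakGradient v' G' := by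
  intro φ hφ hc e
  have hleft : ∫ x, v' x * fderiv ℝ φ x e = ∫ x, v x * fderiv ℝ φ x e :=
    integral_congr_ae (by filter_upwards [hv] with x hx using by rw [hx])
  have hright : ∫ x, inner ℝ (G' x) e * φ x = ∫ x, inner ℝ (G x) e * φ x :=
    integral_congr_ae (by filter_upwards [hG] with x hx using by rw [hx])
  rw [hleft, hright, h φ hφ hc e]

/-- The Hilbert space `L²(ℝ³) × L²(ℝ³; ℝ³)` in which a function is paired with its gradient. -/
abbrev L2Pair : Type :=
  WithLp 2 (Lp ℝ 2 (volume : Measure E3) × Lp E3 2 (volume : Measure E3))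

/-- The element of `L2Pair` represented by two square integrable functions. -/
noncomputable def l2Pair {g : E3 → ℝ} {k : E3 → E3} (hg : MemLp g 2 volume)
    (hk : MemLp k 2 volume) : L2Pair :=
  WithLp.toLp 2 (hg.toLp g, hk.toLp k)

theorem l2Pair_fst {g : E3 → ℝ} {k : E3 → E3} (hg : MemLp g 2 volume)
    (hk : MemLp k 2 volume) : (l2Pair hg hk).fst =ᵐ[volume] g :=
  hg.coeFn_toLp

theorem l2Pair_snd {g : E3 → ℝ} {k : E3 → E3} (hg : MemLp g 2 volume)
    (hk : MemLp k 2 volume) : (l2Pair hg hk).snd =ᵐ[volume] k :=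
  hk.coeFn_toLp

theorem inner_l2Pair {g : E3 → ℝ} {k : E3 → E3} (hg : MemLp g 2 volume)
    (hk : MemLp k 2 volume) (p : L2Pair) :
    inner ℝ (l2Pair hg hk) p = (∫ x, p.fst x * g x) + ∫ x, inner ℝ (p.snd x) (k x) := by
  rw [WithLp.prod_inner_apply, L2.inner_def, L2.inner_def]
  congr 1
  · refine integral_congr_ae ?_
    filter_upwards [l2Pair_fst hg hk] with x hx
    simp [hx]
  · refine integral_congr_ae ?_
    filter_upwards [l2Pair_snd hg hk] with x hx
    change inner ℝ ((l2Pair hg hk).snd x) (p.snd x) = _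
    rw [hx, real_inner_comm]

/-- The pairs `(τ v, ∇v)` with `v ∈ H¹(ℝ³)`, written as the orthogonal complement of the pairs that
express weak differentiability so that it is visibly closed. The factor `τ` makes the norm of
`L2Pair` the energy `∫ |∇v|² + τ² v²` of the equation. -/
noncomputable def weakGraph (τ : ℝ) : Submodule ℝ L2Pair :=
  (Submodule.span ℝ {p | ∃ (φ : E3 → ℝ) (hφ : IsTestFunction φ) (e : E3),
    p = l2Pair (((hφ.dirDeriv e).memLp 2 volume).const_mul τ⁻¹)
      (hφ.memLp_smul_const e 2 volume)})ᗮ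

theorem mem_weakGraph_iff {τ : ℝ} {p : L2Pair} :
    p ∈ weakGraph τ ↔ IsWeakGradient (fun x => τ⁻¹ * p.fst x) p.snd := by
  have hspan : p ∈ weakGraph τ ↔ ∀ (φ : E3 → ℝ) (hφ : IsTestFunction φ) (e : E3),
      inner ℝ (l2Pair (((hφ.dirDeriv e).memLp 2 volume).const_mul τ⁻¹)
        (hφ.memLp_smul_const e 2 volume)) p = 0 := by
    rw [weakGraph, ← Submodule.span_singleton_le_iff_mem, ← Submodule.isOrtho_iff_le,
      Submodule.isOrtho_comm, Submodule.isOrtho_span]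
    simp only [Set.mem_ofPred_eq, Set.mem_singleton_iff, forall_eq]
    exact ⟨fun h φ hφ e => h ⟨φ, hφ, e, rfl⟩, by rintro h _ ⟨φ, hφ, e, rfl⟩; exact h φ hφ e⟩
  have hpairing {φ : E3 → ℝ} (hφ : IsTestFunction φ) (e : E3) :
      inner ℝ (l2Pair (((hφ.dirDeriv e).memLp 2 volume).const_mul τ⁻¹)
        (hφ.memLp_smul_const e 2 volume)) p
      = (∫ x, τ⁻¹ * p.fst x * fderiv ℝ φ x e) + ∫ x, inner ℝ (p.snd x) e * φ x := by
    simp only [inner_l2Pair, inner_smul_right, dirDeriv, mul_comm (φ _), mul_left_comm _ τ⁻¹,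
      mul_assoc]
  refine hspan.trans ⟨fun h φ hφ hc e => ?_, fun h φ hφ e => ?_⟩
  · rw [eq_neg_iff_add_eq_zero, ← hpairing ⟨hφ, hc⟩ e, h φ ⟨hφ, hc⟩ e]
  · rw [hpairing hφ e, ← eq_neg_iff_add_eq_zero, h φ hφ.contDiff hφ.hasCompactSupport e]

theorem IsTestFunction.l2Pair_gradient_mem_weakGraph {φ : E3 → ℝ} (hφ : IsTestFunction φ) {τ : ℝ}
    (hτ : τ ≠ 0) :
    l2Pair ((hφ.memLp 2 volume).const_mul τ) (hφ.gradient_memLp 2 volume) ∈ weakGraph τ := by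
  refine mem_weakGraph_iff.2 (hφ.isWeakGradient_gradient.congr ?_ (l2Pair_snd _ _).symm)
  filter_upwards [l2Pair_fst ((hφ.memLp 2 volume).const_mul τ) (hφ.gradient_memLp 2 volume)]
    with x hx
  rw [hx, inv_mul_cancel_left₀ hτ]

-- Riesz representation: the solution represents `φ ↦ ∫ f φ = ⟪(τ φ, ∇φ), (τ⁻¹ f, 0)⟫` on the
-- closed subspace `weakGraph τ`, so it is the orthogonal projection of `(τ⁻¹ f, 0)`.
theorem exists_isWeakSolution {τ : ℝ} (hτ : τ ≠ 0) {f : E3 → ℝ} (hf : MemLp f 2 volume) :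
    ∃ (v : E3 → ℝ) (G : E3 → E3), IsWeakSolution τ f v G := by
  have : CompleteSpace (weakGraph τ) := by unfold weakGraph; infer_instance
  let X : L2Pair := l2Pair (hf.const_mul τ⁻¹) (MemLp.zero (ε := E3))
  let P : L2Pair := (weakGraph τ).starProjection X
  have hP : P ∈ weakGraph τ := Submodule.starProjection_apply_mem _ _
  refine ⟨fun x => τ⁻¹ * P.fst x, P.snd, (Lp.memLp P.fst).const_mul _, Lp.memLp P.snd,
    mem_weakGraph_iff.1 hP, fun φ hφ hc => ?_⟩
  have htest : IsTestFunction φ := ⟨hφ, hc⟩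
  have hprojection : inner ℝ (l2Pair ((htest.memLp 2 volume).const_mul τ)
      (htest.gradient_memLp 2 volume)) P = inner ℝ (l2Pair ((htest.memLp 2 volume).const_mul τ)
      (htest.gradient_memLp 2 volume)) X := by
    have := Submodule.sub_starProjection_mem_orthogonal X _
      (htest.l2Pair_gradient_mem_weakGraph hτ)
    rwa [inner_sub_right, sub_eq_zero, eq_comm] at this
  have hX_fst : ∫ x, X.fst x * (τ * φ x) = ∫ x, f x * φ x := by
    refine integral_congr_ae ?_
    filter_upwards [l2Pair_fst (hf.const_mul τ⁻¹) MemLp.zero] with x hx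
    rw [hx]
    field_simp
  have hX_snd : ∫ x, inner ℝ (X.snd x) (gradient φ x) = 0 := by
    refine integral_eq_zero_of_ae ?_
    filter_upwards [l2Pair_snd (hf.const_mul τ⁻¹) MemLp.zero] with x hx
    rw [hx, Pi.zero_apply, inner_zero_left, Pi.zero_apply]
  have hP_fst : τ ^ 2 * ∫ x, τ⁻¹ * P.fst x * φ x = ∫ x, P.fst x * (τ * φ x) := by
    rw [← integral_const_mul]
    congr with x
    field_simp
  rw [hP_fst, add_comm, ← inner_l2Pair ((htest.memLp 2 volume).const_mul τ)
    (htest.gradient_memLp 2 volume), hprojection, inner_l2Pair, hX_fst, hX_snd, add_zero]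

end Existence

/-! ### Testing the equation against square integrable functions -/

namespace IsWeakSolution

variable {τ : ℝ} {f v : E3 → ℝ} {G : E3 → E3}

theorem integral_inner_gradient (h : IsWeakSolution τ f v G) {φ : E3 → ℝ}
    (hφ : IsTestFunction φ) : ∫ x, inner ℝ (G x) (gradient φ x) = -∫ x, v x * Δ φ x := by
  set b := stdOrthonormalBasis ℝ E3
  have hparseval (x : E3) : inner ℝ (G x) (gradient φ x)
      = ∑ i, inner ℝ (G x) (b i) * dirDeriv (b i) φ x := by
    rw [← b.sum_inner_mul_inner]
    refine Finset.sum_congr rfl fun i _ => ?_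
    rw [inner_gradient_right, conj_trivial, dirDeriv]
  have hpartial (i) : ∫ x, inner ℝ (G x) (b i) * dirDeriv (b i) φ x
      = -∫ x, v x * dirDeriv (b i) (dirDeriv (b i) φ) x := by
    rw [eq_neg_iff_add_eq_zero, ← neg_eq_iff_add_eq_zero]
    exact (h.weakGradient _ (hφ.dirDeriv _).contDiff (hφ.dirDeriv _).hasCompactSupport _).symm
  have hint (i) : Integrable fun x => inner ℝ (G x) (b i) * dirDeriv (b i) φ x :=
    (h.memLp_grad.inner_const (b i)).integrable_mul ((hφ.dirDeriv (b i)).memLp 2 volume)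
  have hint' (i) : Integrable fun x => v x * dirDeriv (b i) (dirDeriv (b i) φ) x :=
    h.memLp.integrable_mul (((hφ.dirDeriv (b i)).dirDeriv (b i)).memLp 2 volume)
  simp only [hparseval, laplacian_eq_sum_dirDeriv b (hφ.contDiff.of_le ENat.LEInfty.out),
    Finset.mul_sum]
  rw [integral_finsetSum _ fun i _ => hint i, integral_finsetSum _ fun i _ => hint' i]
  simp only [hpartial, Finset.sum_neg_distrib]

theorem integral_mul_helmholtz_of_isTestFunction (h : IsWeakSolution τ f v G) {φ : E3 → ℝ}
    (hφ : IsTestFunction φ) :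
    τ ^ 2 * (∫ x, v x * φ x) - ∫ x, v x * Δ φ x = ∫ x, f x * φ x := by
  rw [← h.equation φ hφ.contDiff hφ.hasCompactSupport, h.integral_inner_gradient hφ]
  ring

theorem integral_grad_mul_helmholtz_of_isTestFunction (h : IsWeakSolution τ f v G) {φ : E3 → ℝ}
    (hφ : IsTestFunction φ) (e : E3) :
    τ ^ 2 * (∫ x, inner ℝ (G x) e * φ x) - ∫ x, inner ℝ (G x) e * Δ φ x
      = -∫ x, f x * dirDeriv e φ x := by
  have hgrad {ψ : E3 → ℝ} (hψ : IsTestFunction ψ) :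
      ∫ x, inner ℝ (G x) e * ψ x = -∫ x, v x * dirDeriv e ψ x := by
    rw [eq_neg_iff_add_eq_zero, ← neg_eq_iff_add_eq_zero]
    exact (h.weakGradient ψ hψ.contDiff hψ.hasCompactSupport e).symm
  rw [hgrad hφ, hgrad hφ.laplacian, ← h.integral_mul_helmholtz_of_isTestFunction (hφ.dirDeriv e),
    laplacian_dirDeriv (hφ.contDiff.of_le ENat.LEInfty.out)]
  ring

theorem integral_mul_helmholtz (h : IsWeakSolution τ f v G) (hf : MemLp f 2 volume) {φ : E3 → ℝ}
    (hφ : IsSmoothH2 volume φ) :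
    τ ^ 2 * (∫ x, v x * φ x) - ∫ x, v x * Δ φ x = ∫ x, f x * φ x := by
  obtain ⟨φ', hφ', hφ'_lim, -, hφ'_laplacian⟩ := hφ.exists_weakApprox
  have hleft := ((hφ'_lim.tendsto_integral_mul v h.memLp).const_mul (τ ^ 2)).sub
    (hφ'_laplacian.tendsto_integral_mul v h.memLp)
  simp only [h.integral_mul_helmholtz_of_isTestFunction (hφ' _)] at hleft
  exact tendsto_nhds_unique hleft (hφ'_lim.tendsto_integral_mul f hf)

theorem integral_grad_mul_helmholtz (h : IsWeakSolution τ f v G) (hf : MemLp f 2 volume)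
    {φ : E3 → ℝ} (hφ : IsSmoothH2 volume φ) (e : E3) :
    τ ^ 2 * (∫ x, inner ℝ (G x) e * φ x) - ∫ x, inner ℝ (G x) e * Δ φ x
      = -∫ x, f x * dirDeriv e φ x := by
  obtain ⟨φ', hφ', hφ'_lim, hφ'_dirDeriv, hφ'_laplacian⟩ := hφ.exists_weakApprox
  have hGe := h.memLp_grad.inner_const (𝕜 := ℝ) e
  have hleft := ((hφ'_lim.tendsto_integral_mul _ hGe).const_mul (τ ^ 2)).sub
    (hφ'_laplacian.tendsto_integral_mul _ hGe)
  simp only [h.integral_grad_mul_helmholtz_of_isTestFunction (hφ' _)] at hleft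
  exact tendsto_nhds_unique hleft ((hφ'_dirDeriv e).tendsto_integral_mul f hf).neg

end IsWeakSolution

/-! ### Integral estimates -/

section IntegralEstimates

theorem mul_measureReal_le_integral {X : Type*} [MeasurableSpace X] {μ : Measure X} {F : X → ℝ}
    {s : Set X} {m : ℝ} (hF : Integrable F μ) (hF_nonneg : 0 ≤ᵐ[μ] F) (hs : MeasurableSet s)
    (hs_fin : μ s ≠ ⊤) (hm : ∀ᵐ x ∂μ, x ∈ s → m ≤ F x) : m * μ.real s ≤ ∫ x, F x ∂μ :=
  calc m * μ.real s = ∫ _ in s, m ∂μ := by rw [setIntegral_const, smul_eq_mul, mul_comm]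
    _ ≤ ∫ x in s, F x ∂μ :=
      setIntegral_mono_on_ae (integrableOn_const hs_fin) hF.integrableOn hs hm
    _ ≤ ∫ x, F x ∂μ := setIntegral_le_integral hF hF_nonneg

variable {E : Type*} [NormedAddCommGroup E] [NormedSpace ℝ E] [FiniteDimensional ℝ E]
  [MeasurableSpace E] [BorelSpace E] {μ : Measure E} [μ.IsAddHaarMeasure]

theorem memLp_two_comp_smul_sub {F : E → ℝ} (hF : MemLp F 2 μ) (hFc : Continuous F) {c : ℝ}
    (hc : c ≠ 0) (a : E) : MemLp (fun x => F (c • (x - a))) 2 μ := by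
  have hcont : Continuous fun x => F (c • (x - a)) := by fun_prop
  rw [memLp_two_iff_integrable_sq hcont.aestronglyMeasurable]
  exact (hF.integrable_sq.comp_smul hc).comp_sub_right a

variable [Nontrivial E]

theorem integrable_exp_neg_mul_norm {c : ℝ} (hc : 0 < c) :
    Integrable (fun x : E => Real.exp (-(c * ‖x‖))) μ := by
  refine (integrable_fun_norm_addHaar μ (f := fun r : ℝ => Real.exp (-(c * r)))).2 ?_
  have hdim : (-1 : ℝ) < (Module.finrank ℝ E - 1 : ℕ) := by
    linarith [(Module.finrank ℝ E - 1).cast_nonneg (α := ℝ)]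
  refine (integrableOn_rpow_mul_exp_neg_mul_rpow hdim one_pos hc).congr_fun (fun r _ => ?_)
    measurableSet_Ioi
  simp

theorem integrable_of_isBigO_exp_neg_mul_norm {F : E → ℝ} (hF : Continuous F) {c : ℝ} (hc : 0 < c)
    (h : F =O[cocompact E] fun x => Real.exp (-(c * ‖x‖))) : Integrable F μ :=
  hF.locallyIntegrable.integrable_of_isBigO_cocompact h
    ((integrable_exp_neg_mul_norm hc).integrableAtFilter _)

theorem memLp_two_of_isBigO_exp_neg_mul_norm {F : E → ℝ} (hF : Continuous F) {c : ℝ} (hc : 0 < c)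
    (h : F =O[cocompact E] fun x => Real.exp (-(c * ‖x‖))) : MemLp F 2 μ := by
  rw [memLp_two_iff_integrable_sq hF.aestronglyMeasurable]
  refine integrable_of_isBigO_exp_neg_mul_norm (hF.pow 2) (mul_pos two_pos hc) ?_
  refine (h.pow 2).congr_right fun x => ?_
  rw [← Real.exp_nat_mul]
  congr 1
  push_cast
  ring

end IntegralEstimates

/-! ### The truncated Yukawa potential -/

/-- A smooth cutoff in the variable `u = ‖z‖²`, equal to `0` for `u ≤ 1/2` and to `1` for
`1 ≤ u`; it removes the singularity of the Yukawa potential. -/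
noncomputable def radialCutoff (u : ℝ) : ℝ := Real.smoothTransition (2 * u - 1)

/-- The Yukawa potential `e^{-μr} / r` as a function of `u = r²`. -/
noncomputable def yukawaProfile (μ u : ℝ) : ℝ := Real.exp (-(μ * √u)) / √u

/-- The derivative of `yukawaProfile μ` on the positive half-line. -/
noncomputable def yukawaProfileDeriv (μ u : ℝ) : ℝ :=
  -(Real.exp (-(μ * √u)) * (μ * √u + 1) / (2 * √u ^ 3))

/-- The truncated Yukawa potential as a function of `u = r²`. -/
noncomputable def truncYukawaProfile (μ u : ℝ) : ℝ := radialCutoff u * yukawaProfile μ u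

/-- The image of the truncated Yukawa potential under `μ² - Δ` as a function of `u = r²`. Since the
Yukawa potential itself is annihilated, only terms with a derivative of the cutoff occur. -/
noncomputable def yukawaSourceProfile (μ u : ℝ) : ℝ :=
  -(6 * deriv radialCutoff u + 4 * u * deriv (deriv radialCutoff) u) * yukawaProfile μ u
    - 8 * u * deriv radialCutoff u * yukawaProfileDeriv μ u

section Profile

theorem contDiff_radialCutoff : ContDiff ℝ ∞ radialCutoff :=
  Real.smoothTransition.contDiff.comp (by fun_prop)

theorem radialCutoff_of_le {u : ℝ} (hu : u ≤ 1 / 2) : radialCutoff u = 0 :=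
  Real.smoothTransition.zero_of_nonpos (by linarith)

theorem radialCutoff_of_ge {u : ℝ} (hu : 1 ≤ u) : radialCutoff u = 1 :=
  Real.smoothTransition.one_of_one_le (by linarith)

theorem radialCutoff_eventuallyEq_const {u : ℝ} (hu : u ∉ Set.Icc (1 / 2) 1) :
    ∃ c, radialCutoff =ᶠ[𝓝 u] fun _ => c := by
  rw [Set.mem_Icc, not_and_or, not_le, not_le] at hu
  rcases hu with hu | hu
  · exact ⟨0, by filter_upwards [Iio_mem_nhds hu] with y hy using radialCutoff_of_le hy.le⟩
  · exact ⟨1, by filter_upwards [Ioi_mem_nhds hu] with y hy using radialCutoff_of_ge hy.le⟩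

theorem yukawaSourceProfile_eq_zero (μ : ℝ) {u : ℝ} (hu : u ∉ Set.Icc (1 / 2) 1) :
    yukawaSourceProfile μ u = 0 := by
  obtain ⟨c, hc⟩ := radialCutoff_eventuallyEq_const hu
  simp [yukawaSourceProfile, hc.deriv_eq, hc.deriv.deriv_eq]

theorem hasDerivAt_exp_neg_mul_sqrt (μ : ℝ) {u : ℝ} (hu : u ≠ 0) :
    HasDerivAt (fun u => Real.exp (-(μ * √u))) (Real.exp (-(μ * √u)) * -(μ * (1 / (2 * √u)))) u :=
  ((Real.hasDerivAt_sqrt hu).const_mul μ).neg.exp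

theorem hasDerivAt_yukawaProfile (μ : ℝ) {u : ℝ} (hu : 0 < u) :
    HasDerivAt (yukawaProfile μ) (yukawaProfileDeriv μ u) u := by
  have hs : 0 < √u := Real.sqrt_pos.2 hu
  refine ((hasDerivAt_exp_neg_mul_sqrt μ hu.ne').div (Real.hasDerivAt_sqrt hu.ne')
    hs.ne').congr_deriv ?_
  unfold yukawaProfileDeriv
  field_simp
  ring

-- In the variable `u = r²` the equation `(μ² - Δ) y = 0` in dimension three reads
-- `4 u y'' + 6 y' = μ² y`.
theorem hasDerivAt_yukawaProfileDeriv (μ : ℝ) {u : ℝ} (hu : 0 < u) :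
    HasDerivAt (yukawaProfileDeriv μ)
      ((μ ^ 2 * yukawaProfile μ u - 6 * yukawaProfileDeriv μ u) / (4 * u)) u := by
  have hs : 0 < √u := Real.sqrt_pos.2 hu
  have hsqrt := Real.hasDerivAt_sqrt hu.ne'
  have hcube : HasDerivAt (fun u => 2 * √u ^ 3) (2 * (3 * √u ^ 2 * (1 / (2 * √u)))) u := by
    simpa using (hsqrt.fun_pow 3).const_mul 2
  refine ((((hasDerivAt_exp_neg_mul_sqrt μ hu.ne').fun_mul
    ((hsqrt.const_mul μ).add_const 1)).fun_div hcube (by positivity)).fun_neg).congr_deriv ?_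
  have hu_sq : u = √u ^ 2 := (Real.sq_sqrt hu.le).symm
  unfold yukawaProfileDeriv yukawaProfile
  clear hsqrt hcube
  generalize √u = s at *
  subst hu_sq
  field_simp
  ring

theorem truncYukawaProfile_eventuallyEq_zero (μ : ℝ) {u : ℝ} (hu : u < 1 / 2) :
    truncYukawaProfile μ =ᶠ[𝓝 u] fun _ => 0 := by
  filter_upwards [Iio_mem_nhds hu] with y hy
  rw [truncYukawaProfile, radialCutoff_of_le hy.le, zero_mul]

theorem contDiff_truncYukawaProfile (μ : ℝ) : ContDiff ℝ ∞ (truncYukawaProfile μ) := by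
  refine contDiff_iff_contDiffAt.2 fun u => ?_
  rcases lt_or_ge u (1 / 2) with hu | hu
  · exact contDiffAt_const.congr_of_eventuallyEq (truncYukawaProfile_eventuallyEq_zero μ hu)
  · have hu0 : 0 < u := by linarith
    have hsqrt : ContDiffAt ℝ ∞ Real.sqrt u := Real.contDiffAt_sqrt hu0.ne'
    exact contDiff_radialCutoff.contDiffAt.mul
      (((contDiffAt_const.mul hsqrt).neg.exp).div hsqrt (Real.sqrt_pos.2 hu0).ne')

theorem deriv_truncYukawaProfile (μ : ℝ) {u : ℝ} (hu : 0 < u) :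
    deriv (truncYukawaProfile μ) u
      = deriv radialCutoff u * yukawaProfile μ u + radialCutoff u * yukawaProfileDeriv μ u :=
  ((contDiff_radialCutoff.differentiable (by simp) u).hasDerivAt.mul
    (hasDerivAt_yukawaProfile μ hu)).deriv

theorem deriv_deriv_truncYukawaProfile (μ : ℝ) {u : ℝ} (hu : 0 < u) :
    deriv (deriv (truncYukawaProfile μ)) u = deriv (deriv radialCutoff) u * yukawaProfile μ u
      + 2 * deriv radialCutoff u * yukawaProfileDeriv μ u
      + radialCutoff u * ((μ ^ 2 * yukawaProfile μ u - 6 * yukawaProfileDeriv μ u) / (4 * u)) := by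
  have hderiv : deriv (truncYukawaProfile μ) =ᶠ[𝓝 u] fun u =>
      deriv radialCutoff u * yukawaProfile μ u + radialCutoff u * yukawaProfileDeriv μ u := by
    filter_upwards [Ioi_mem_nhds hu] with y hy using deriv_truncYukawaProfile μ hy
  have hcut := (contDiff_radialCutoff.differentiable (by simp) u).hasDerivAt
  have hcut' := ((contDiff_infty_iff_deriv.1 contDiff_radialCutoff).2.differentiable
    (by simp) u).hasDerivAt
  rw [hderiv.deriv_eq]
  refine ((hcut'.mul (hasDerivAt_yukawaProfile μ hu)).add
    (hcut.mul (hasDerivAt_yukawaProfileDeriv μ hu))).deriv.trans ?_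
  ring

theorem helmholtz_truncYukawaProfile (μ u : ℝ) :
    μ ^ 2 * truncYukawaProfile μ u - (4 * u * deriv (deriv (truncYukawaProfile μ)) u
      + 6 * deriv (truncYukawaProfile μ) u) = yukawaSourceProfile μ u := by
  rcases lt_or_ge u (1 / 2) with hu | hu
  · have hzero := truncYukawaProfile_eventuallyEq_zero μ hu
    rw [yukawaSourceProfile_eq_zero μ fun h => hu.not_ge h.1]
    simp [hzero.eq_of_nhds, hzero.deriv_eq, hzero.deriv.deriv_eq]
  · have hu0 : 0 < u := by linarith
    rw [deriv_truncYukawaProfile μ hu0, deriv_deriv_truncYukawaProfile μ hu0, truncYukawaProfile,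
      yukawaSourceProfile]
    field_simp
    ring

theorem exists_bound_yukawaSourceProfile (M : ℝ) :
    ∃ C : ℝ, ∀ μ ∈ Set.Icc 0 M, ∀ u, |yukawaSourceProfile μ u| ≤ C := by
  have hcut' : ContDiff ℝ ∞ (deriv radialCutoff) :=
    (contDiff_infty_iff_deriv.1 contDiff_radialCutoff).2
  have hcut'_cont := hcut'.continuous
  have hcut''_cont := (contDiff_infty_iff_deriv.1 hcut').2.continuous
  have hcont : ContinuousOn (fun p : ℝ × ℝ => yukawaSourceProfile p.1 p.2)
      (Set.Icc 0 M ×ˢ Set.Icc (1 / 2) 1) := by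
    have hsqrt : ∀ p ∈ Set.Icc 0 M ×ˢ Set.Icc (1 / 2 : ℝ) 1, √p.2 ≠ 0 := fun p hp =>
      (Real.sqrt_pos.2 (one_half_pos.trans_le hp.2.1)).ne'
    have hcube : ∀ p ∈ Set.Icc 0 M ×ˢ Set.Icc (1 / 2 : ℝ) 1, 2 * √p.2 ^ 3 ≠ 0 := fun p hp =>
      mul_ne_zero two_ne_zero (pow_ne_zero 3 (hsqrt p hp))
    unfold yukawaSourceProfile yukawaProfile yukawaProfileDeriv
    fun_prop (disch := assumption)
  obtain ⟨C, hC⟩ := (isCompact_Icc.prod isCompact_Icc).exists_bound_of_continuousOn hcont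
  refine ⟨max C 0, fun μ hμ u => ?_⟩
  by_cases hu : u ∈ Set.Icc (1 / 2) 1
  · exact (hC (μ, u) ⟨hμ, hu⟩).trans (le_max_left _ _)
  · rw [yukawaSourceProfile_eq_zero μ hu, abs_zero]
    exact le_max_right _ _

end Profile

/-- The Yukawa potential `e^{-μ‖z‖} / ‖z‖` on `ℝ³`, smoothly truncated inside the unit ball. -/
noncomputable def truncYukawa (μ : ℝ) (z : E3) : ℝ := truncYukawaProfile μ (‖z‖ ^ 2)

/-- The source `(μ² - Δ) F` of the truncated Yukawa potential `F`. -/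
noncomputable def yukawaSource (μ : ℝ) (z : E3) : ℝ :=
  μ ^ 2 * truncYukawa μ z - Δ (truncYukawa μ) z

section TruncYukawa

theorem contDiff_truncYukawa (μ : ℝ) : ContDiff ℝ ∞ (truncYukawa μ) :=
  (contDiff_truncYukawaProfile μ).comp (contDiff_norm_sq ℝ)

theorem truncYukawa_nonneg (μ : ℝ) (z : E3) : 0 ≤ truncYukawa μ z :=
  mul_nonneg (Real.smoothTransition.nonneg _) (div_nonneg (Real.exp_pos _).le (Real.sqrt_nonneg _))

theorem truncYukawa_of_ge (μ : ℝ) {z : E3} (hz : 1 ≤ ‖z‖) :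
    truncYukawa μ z = Real.exp (-(μ * ‖z‖)) / ‖z‖ := by
  rw [truncYukawa, truncYukawaProfile, radialCutoff_of_ge (one_le_pow₀ hz), yukawaProfile,
    Real.sqrt_sq (norm_nonneg z), one_mul]

theorem yukawaSource_eq (μ : ℝ) (z : E3) :
    yukawaSource μ z = yukawaSourceProfile μ (‖z‖ ^ 2) := by
  have hlaplacian := congrFun (laplacian_comp_norm_sq (E := E3)
    ((contDiff_truncYukawaProfile μ).of_le ENat.LEInfty.out)) z
  rw [← helmholtz_truncYukawaProfile, ← truncYukawa, yukawaSource]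
  congr 1
  refine hlaplacian.trans ?_
  rw [finrank_euclideanSpace_fin]
  norm_num

theorem yukawaSource_of_gt (μ : ℝ) {z : E3} (hz : 1 < ‖z‖) : yukawaSource μ z = 0 := by
  rw [yukawaSource_eq]
  exact yukawaSourceProfile_eq_zero μ fun h => (one_lt_pow₀ hz two_ne_zero).not_ge h.2

theorem isTestFunction_yukawaSource (μ : ℝ) : IsTestFunction (yukawaSource μ) where
  contDiff := (contDiff_const.mul (contDiff_truncYukawa μ)).sub
    (contDiff_laplacian (contDiff_truncYukawa μ) le_rfl)
  hasCompactSupport := HasCompactSupport.intro (isCompact_closedBall (0 : E3) 1) fun z hz =>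
    yukawaSource_of_gt μ (by simpa using hz)

theorem exists_bound_yukawaSource :
    ∃ C : ℝ, ∀ μ : ℝ, 0 < μ → μ ≤ 1 → ∀ z, |yukawaSource μ z| ≤ C := by
  obtain ⟨C, hC⟩ := exists_bound_yukawaSourceProfile 1
  exact ⟨C, fun μ hμ hμ1 z => yukawaSource_eq μ z ▸ hC μ ⟨hμ.le, hμ1⟩ _⟩

theorem laplacian_truncYukawa_of_gt (μ : ℝ) {z : E3} (hz : 1 < ‖z‖) :
    Δ (truncYukawa μ) z = μ ^ 2 * truncYukawa μ z :=
  (sub_eq_zero.1 (yukawaSource_of_gt μ hz)).symm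

theorem abs_dirDeriv_truncYukawa_le {μ : ℝ} (hμ : 0 < μ) {z : E3} (hz : 1 < ‖z‖) (e : E3) :
    |dirDeriv e (truncYukawa μ) z| ≤ Real.exp (-(μ * ‖z‖)) * (μ / ‖z‖ + 1 / ‖z‖ ^ 2) * ‖e‖ := by
  have hz0 : 0 < ‖z‖ := by linarith
  have hz_sq : 1 < ‖z‖ ^ 2 := one_lt_pow₀ hz two_ne_zero
  obtain ⟨c, hc⟩ := radialCutoff_eventuallyEq_const fun h => hz_sq.not_ge h.2
  have hderiv : deriv (truncYukawaProfile μ) (‖z‖ ^ 2) = yukawaProfileDeriv μ (‖z‖ ^ 2) := by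
    rw [deriv_truncYukawaProfile μ (by positivity), radialCutoff_of_ge hz_sq.le, hc.deriv_eq]
    simp
  have hdirDeriv : dirDeriv e (truncYukawa μ) z
      = -(Real.exp (-(μ * ‖z‖)) * (μ / ‖z‖ + 1 / ‖z‖ ^ 2) / ‖z‖ * inner ℝ z e) := by
    refine (congrFun (dirDeriv_comp_norm_sq
      ((contDiff_truncYukawaProfile μ).differentiable (by simp)) e) z).trans ?_
    rw [hderiv, yukawaProfileDeriv, Real.sqrt_sq hz0.le]
    field_simp
  rw [hdirDeriv, abs_neg, abs_mul, abs_of_nonneg (by positivity)]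
  calc _ ≤ Real.exp (-(μ * ‖z‖)) * (μ / ‖z‖ + 1 / ‖z‖ ^ 2) / ‖z‖ * (‖z‖ * ‖e‖) := by
        gcongr
        exact abs_real_inner_le_norm z e
    _ = _ := by field_simp

theorem truncYukawa_isBigO (μ : ℝ) :
    truncYukawa μ =O[cocompact E3] fun z => Real.exp (-(μ * ‖z‖)) := by
  refine Asymptotics.IsBigO.of_bound 1 ?_
  filter_upwards [(tendsto_norm_cocompact_atTop (E := E3)).eventually_gt_atTop 1] with z hz
  rw [one_mul, truncYukawa_of_ge μ hz.le, norm_div, norm_norm]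
  exact div_le_self (norm_nonneg _) hz.le

theorem dirDeriv_truncYukawa_isBigO {μ : ℝ} (hμ : 0 < μ) (e : E3) :
    dirDeriv e (truncYukawa μ) =O[cocompact E3] fun z => Real.exp (-(μ * ‖z‖)) := by
  refine Asymptotics.IsBigO.of_bound ((μ + 1) * ‖e‖) ?_
  filter_upwards [(tendsto_norm_cocompact_atTop (E := E3)).eventually_gt_atTop 1] with z hz
  have hμz : μ / ‖z‖ ≤ μ := div_le_self hμ.le hz.le
  have hz_sq : 1 / ‖z‖ ^ 2 ≤ 1 := div_le_self zero_le_one (one_le_pow₀ hz.le)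
  calc _ ≤ Real.exp (-(μ * ‖z‖)) * (μ / ‖z‖ + 1 / ‖z‖ ^ 2) * ‖e‖ :=
        abs_dirDeriv_truncYukawa_le hμ hz e
    _ ≤ Real.exp (-(μ * ‖z‖)) * (μ + 1) * ‖e‖ := by gcongr
    _ = _ := by rw [Real.norm_eq_abs, Real.abs_exp]; ring

theorem laplacian_truncYukawa_isBigO (μ : ℝ) :
    Δ (truncYukawa μ) =O[cocompact E3] fun z => Real.exp (-(μ * ‖z‖)) := by
  refine ((truncYukawa_isBigO μ).const_mul_left (μ ^ 2)).congr' ?_ EventuallyEq.rfl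
  filter_upwards [(tendsto_norm_cocompact_atTop (E := E3)).eventually_gt_atTop 1] with z hz
  exact (laplacian_truncYukawa_of_gt μ hz).symm

theorem isSmoothH2_truncYukawa {μ : ℝ} (hμ : 0 < μ) : IsSmoothH2 volume (truncYukawa μ) where
  contDiff := contDiff_truncYukawa μ
  memLp := memLp_two_of_isBigO_exp_neg_mul_norm (contDiff_truncYukawa μ).continuous hμ
    (truncYukawa_isBigO μ)
  memLp_dirDeriv e := memLp_two_of_isBigO_exp_neg_mul_norm
    (contDiff_dirDeriv (m := ∞) (contDiff_truncYukawa μ) le_rfl e).continuous hμ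
    (dirDeriv_truncYukawa_isBigO hμ e)
  memLp_laplacian := memLp_two_of_isBigO_exp_neg_mul_norm
    (contDiff_laplacian (m := ∞) (contDiff_truncYukawa μ) le_rfl).continuous hμ
    (laplacian_truncYukawa_isBigO μ)

theorem integral_yukawaSource {μ : ℝ} (hμ : 0 < μ) :
    ∫ z, yukawaSource μ z = μ ^ 2 * ∫ z, truncYukawa μ z := by
  have hint : Integrable (truncYukawa μ) volume := integrable_of_isBigO_exp_neg_mul_norm
    (contDiff_truncYukawa μ).continuous hμ (truncYukawa_isBigO μ)
  have hint' : Integrable (Δ (truncYukawa μ)) volume := integrable_of_isBigO_exp_neg_mul_norm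
    (contDiff_laplacian (m := ∞) (contDiff_truncYukawa μ) le_rfl).continuous hμ
    (laplacian_truncYukawa_isBigO μ)
  unfold yukawaSource
  rw [integral_sub (hint.const_mul _) hint', integral_const_mul,
    integral_laplacian_eq_zero ((contDiff_truncYukawa μ).of_le ENat.LEInfty.out) hint hint',
    sub_zero]

theorem truncYukawa_ge_of_norm_mem_Icc {μ : ℝ} (hμ : 0 < μ) (hμ1 : μ ≤ 1) {z : E3}
    (hz : ‖z‖ ∈ Set.Icc (2 / μ) (4 / μ)) : Real.exp (-4) * μ / 4 ≤ truncYukawa μ z := by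
  have hz_one : 1 ≤ ‖z‖ := ((one_le_div hμ).2 (by linarith)).trans hz.1
  have hz_four : μ * ‖z‖ ≤ 4 := by linarith [(le_div_iff₀' hμ).1 hz.2]
  rw [truncYukawa_of_ge μ hz_one, le_div_iff₀ (by linarith)]
  calc Real.exp (-4) * μ / 4 * ‖z‖ = Real.exp (-4) * (μ * ‖z‖ / 4) := by ring
    _ ≤ Real.exp (-4) * 1 := by gcongr; linarith
    _ ≤ Real.exp (-(μ * ‖z‖)) := by rw [mul_one]; gcongr

-- The ball of radius `1 / μ` about a point at distance `3 / μ` from the origin contributes a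
-- multiple of `μ⁻²` to `∫ truncYukawa μ`.
theorem exists_integral_yukawaSource_ge :
    ∃ κ : ℝ, 0 < κ ∧ ∀ μ : ℝ, 0 < μ → μ ≤ 1 → κ ≤ ∫ z, yukawaSource μ z := by
  set V := (volume : Measure E3).real (Metric.ball 0 1)
  have hV : 0 < V := ENNReal.toReal_pos (Metric.measure_ball_pos _ _ one_pos).ne'
    measure_ball_lt_top.ne
  refine ⟨Real.exp (-4) / 4 * V, by positivity, fun μ hμ hμ1 => ?_⟩
  obtain ⟨p, hp⟩ : ∃ p : E3, ‖p‖ = 3 / μ := exists_norm_eq E3 (by positivity)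
  have hnorm {z : E3} (hz : z ∈ Metric.closedBall p (1 / μ)) :
      ‖z‖ ∈ Set.Icc (2 / μ) (4 / μ) := by
    have hdist := abs_le.1 ((abs_norm_sub_norm_le z p).trans (mem_closedBall_iff_norm.1 hz))
    rw [hp] at hdist
    constructor
    · linarith [hdist.1, show 3 / μ = 2 / μ + 1 / μ by ring]
    · linarith [hdist.2, show 4 / μ = 3 / μ + 1 / μ by ring]
  have hball : Real.exp (-4) * μ / 4 * volume.real (Metric.closedBall p (1 / μ))
      ≤ ∫ z, truncYukawa μ z :=
    mul_measureReal_le_integral (integrable_of_isBigO_exp_neg_mul_norm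
      (contDiff_truncYukawa μ).continuous hμ (truncYukawa_isBigO μ))
      (Eventually.of_forall (truncYukawa_nonneg μ)) measurableSet_closedBall
      measure_closedBall_lt_top.ne
      (Eventually.of_forall fun z hz => truncYukawa_ge_of_norm_mem_Icc hμ hμ1 (hnorm hz))
  rw [Measure.addHaar_real_closedBall _ _ (by positivity), finrank_euclideanSpace_fin] at hball
  rw [integral_yukawaSource hμ]
  calc Real.exp (-4) / 4 * V = μ ^ 2 * (Real.exp (-4) * μ / 4 * ((1 / μ) ^ 3 * V)) := by
        field_simp
    _ ≤ _ := by gcongr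

end TruncYukawa

/-! ### Localized Yukawa potentials -/

namespace IsSmoothH2

variable {E : Type*} [NormedAddCommGroup E] [InnerProductSpace ℝ E] [FiniteDimensional ℝ E]
  [MeasurableSpace E] {μ : Measure E} {φ : E → ℝ}

theorem const_mul (hφ : IsSmoothH2 μ φ) (c : ℝ) : IsSmoothH2 μ fun x => c * φ x where
  contDiff := contDiff_const.mul hφ.contDiff
  memLp := hφ.memLp.const_mul c
  memLp_dirDeriv e := by
    rw [dirDeriv_const_mul (hφ.contDiff.differentiable (by simp))]
    exact (hφ.memLp_dirDeriv e).const_mul c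
  memLp_laplacian := by
    rw [laplacian_const_mul (hφ.contDiff.of_le ENat.LEInfty.out)]
    exact hφ.memLp_laplacian.const_mul c

theorem comp_smul_sub [BorelSpace E] [μ.IsAddHaarMeasure] (hφ : IsSmoothH2 μ φ) {c : ℝ}
    (hc : c ≠ 0) (a : E) : IsSmoothH2 μ fun x => φ (c • (x - a)) where
  contDiff := hφ.contDiff.comp ((contDiff_id.sub contDiff_const).const_smul c)
  memLp := memLp_two_comp_smul_sub hφ.memLp hφ.contDiff.continuous hc a
  memLp_dirDeriv e := by
    rw [dirDeriv_comp_smul_sub (hφ.contDiff.differentiable (by simp))]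
    exact (memLp_two_comp_smul_sub (hφ.memLp_dirDeriv e)
      (contDiff_dirDeriv (m := ∞) hφ.contDiff le_rfl e).continuous hc a).const_mul c
  memLp_laplacian := by
    rw [laplacian_comp_smul_sub (hφ.contDiff.of_le ENat.LEInfty.out)]
    exact (memLp_two_comp_smul_sub hφ.memLp_laplacian
      (contDiff_laplacian (m := ∞) hφ.contDiff le_rfl).continuous hc a).const_mul (c ^ 2)

theorem integral_mul_helmholtz (hφ : IsSmoothH2 μ φ) {g : E → ℝ} (hg : MemLp g 2 μ) (τ : ℝ) :
    ∫ x, g x * (τ ^ 2 * φ x - Δ φ x) ∂μ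
      = τ ^ 2 * (∫ x, g x * φ x ∂μ) - ∫ x, g x * Δ φ x ∂μ := by
  have hint : Integrable (fun x => τ ^ 2 * (g x * φ x)) μ :=
    (hg.integrable_mul hφ.memLp).const_mul _
  have hint' : Integrable (fun x => g x * Δ φ x) μ := hg.integrable_mul hφ.memLp_laplacian
  simp only [mul_sub, mul_left_comm _ (τ ^ 2)]
  rw [integral_sub hint hint', integral_const_mul]

end IsSmoothH2

/-- The Yukawa potential `e^{-τ‖x - a‖} / ‖x - a‖` with pole `a`, smoothly truncated inside the
ball of radius `ε` about `a`. -/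
noncomputable def localYukawa (τ ε : ℝ) (a x : E3) : ℝ :=
  ε⁻¹ * truncYukawa (ε * τ) (ε⁻¹ • (x - a))

/-- The source `(τ² - Δ) F` of the localized Yukawa potential `F`; it is supported in the ball of
radius `ε` about `a`. -/
noncomputable def localSource (τ ε : ℝ) (a x : E3) : ℝ :=
  τ ^ 2 * localYukawa τ ε a x - Δ (localYukawa τ ε a) x

section LocalYukawa

variable {τ ε : ℝ}

theorem norm_inv_smul_of_pos {E : Type*} [SeminormedAddCommGroup E] [NormedSpace ℝ E]
    (hε : 0 < ε) (y : E) : ‖ε⁻¹ • y‖ = ‖y‖ / ε := by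
  rw [norm_smul_of_nonneg (inv_nonneg.2 hε.le), inv_mul_eq_div]

theorem localYukawa_nonneg (τ : ℝ) (hε : 0 < ε) (a x : E3) : 0 ≤ localYukawa τ ε a x :=
  mul_nonneg (inv_nonneg.2 hε.le) (truncYukawa_nonneg _ _)

theorem localYukawa_of_ge (τ : ℝ) (hε : 0 < ε) {a x : E3} (hx : ε ≤ ‖x - a‖) :
    localYukawa τ ε a x = Real.exp (-(τ * ‖x - a‖)) / ‖x - a‖ := by
  have hx_scaled : 1 ≤ ‖ε⁻¹ • (x - a)‖ := by rwa [norm_inv_smul_of_pos hε, one_le_div hε]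
  rw [localYukawa, truncYukawa_of_ge _ hx_scaled, norm_inv_smul_of_pos hε]
  field_simp

theorem dirDeriv_localYukawa (τ ε : ℝ) (a e x : E3) :
    dirDeriv e (localYukawa τ ε a) x
      = (ε ^ 2)⁻¹ * dirDeriv e (truncYukawa (ε * τ)) (ε⁻¹ • (x - a)) := by
  have hF := (contDiff_truncYukawa (ε * τ)).differentiable (by simp)
  unfold localYukawa
  rw [dirDeriv_const_mul (hF.fun_comp (by fun_prop)), dirDeriv_comp_smul_sub hF]
  ring

theorem abs_dirDeriv_localYukawa_le (hτ : 0 < τ) (hε : 0 < ε) {a x : E3} (hx : ε < ‖x - a‖)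
    (e : E3) : |dirDeriv e (localYukawa τ ε a) x|
      ≤ Real.exp (-(τ * ‖x - a‖)) * (τ / ‖x - a‖ + 1 / ‖x - a‖ ^ 2) * ‖e‖ := by
  have hx_scaled : 1 < ‖ε⁻¹ • (x - a)‖ := by rwa [norm_inv_smul_of_pos hε, one_lt_div hε]
  have hbound := abs_dirDeriv_truncYukawa_le (mul_pos hε hτ) hx_scaled e
  rw [norm_inv_smul_of_pos hε] at hbound
  rw [dirDeriv_localYukawa, abs_mul, abs_of_nonneg (by positivity)]
  refine (mul_le_mul_of_nonneg_left hbound (by positivity)).trans_eq ?_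
  field_simp

theorem isSmoothH2_localYukawa (hτ : 0 < τ) (hε : 0 < ε) (a : E3) :
    IsSmoothH2 volume (localYukawa τ ε a) :=
  ((isSmoothH2_truncYukawa (mul_pos hε hτ)).comp_smul_sub (inv_ne_zero hε.ne') a).const_mul ε⁻¹

theorem localSource_eq (τ : ℝ) (hε : ε ≠ 0) (a x : E3) :
    localSource τ ε a x = (ε ^ 3)⁻¹ * yukawaSource (ε * τ) (ε⁻¹ • (x - a)) := by
  have hF : ContDiff ℝ 2 (truncYukawa (ε * τ)) :=
    (contDiff_truncYukawa (ε * τ)).of_le ENat.LEInfty.out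
  have hlaplacian : Δ (localYukawa τ ε a) x
      = ε⁻¹ * ((ε⁻¹) ^ 2 * Δ (truncYukawa (ε * τ)) (ε⁻¹ • (x - a))) := by
    unfold localYukawa
    rw [laplacian_const_mul (hF.fun_comp (by fun_prop)), laplacian_comp_smul_sub hF]
  rw [localSource, hlaplacian, localYukawa, yukawaSource]
  field_simp

theorem localSource_of_notMem (τ : ℝ) (hε : 0 < ε) {a x : E3} (hx : x ∉ Metric.closedBall a ε) :
    localSource τ ε a x = 0 := by
  rw [mem_closedBall_iff_norm, not_le] at hx
  rw [localSource_eq τ hε.ne', yukawaSource_of_gt, mul_zero]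
  rwa [norm_inv_smul_of_pos hε, one_lt_div hε]

theorem isTestFunction_localSource (τ : ℝ) (hε : 0 < ε) (a : E3) :
    IsTestFunction (localSource τ ε a) where
  contDiff := by
    simp only [funext (localSource_eq τ hε.ne' a)]
    exact contDiff_const.mul ((isTestFunction_yukawaSource _).contDiff.comp
      ((contDiff_id.sub contDiff_const).const_smul _))
  hasCompactSupport := HasCompactSupport.intro (isCompact_closedBall a ε) fun _ hx =>
    localSource_of_notMem τ hε hx

theorem integral_localSource (τ : ℝ) (hε : 0 < ε) (a : E3) :
    ∫ x, localSource τ ε a x = ∫ z, yukawaSource (ε * τ) z := by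
  simp only [localSource_eq τ hε.ne', integral_const_mul]
  rw [integral_sub_right_eq_self (fun x => yukawaSource (ε * τ) (ε⁻¹ • x)) a,
    Measure.integral_comp_inv_smul_of_nonneg _ _ hε.le, finrank_euclideanSpace_fin, smul_eq_mul,
    inv_mul_cancel_left₀ (by positivity)]

theorem exists_integral_localSource_ge : ∃ κ : ℝ, 0 < κ ∧ ∀ τ ε : ℝ, 0 < τ → 0 < ε → ε * τ ≤ 1 →
    ∀ a, κ ≤ ∫ x, localSource τ ε a x := by
  obtain ⟨κ, hκ, hle⟩ := exists_integral_yukawaSource_ge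
  exact ⟨κ, hκ, fun τ ε hτ hε hετ a =>
    integral_localSource τ hε a ▸ hle (ε * τ) (mul_pos hε hτ) hετ⟩

theorem exists_bound_localSource : ∃ C : ℝ, ∀ τ ε : ℝ, 0 < τ → 0 < ε → ε * τ ≤ 1 →
    ∀ a x, |localSource τ ε a x| ≤ C / ε ^ 3 := by
  obtain ⟨C, hC⟩ := exists_bound_yukawaSource
  refine ⟨C, fun τ ε hτ hε hετ a x => ?_⟩
  rw [localSource_eq τ hε.ne', abs_mul, abs_of_nonneg (by positivity), inv_mul_eq_div]
  gcongr
  exact hC (ε * τ) (mul_pos hε hτ) hετ _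

theorem exists_bound_gradient_localSource (μ : ℝ) : ∃ N : ℝ, 0 < N ∧ ∀ τ ε : ℝ, 0 < ε →
    ε * τ = μ → ∀ a x, ‖gradient (localSource τ ε a) x‖ ≤ N / ε ^ 4 := by
  have hsource := isTestFunction_yukawaSource μ
  obtain ⟨N, hN⟩ := (hsource.hasCompactSupport.fderiv (𝕜 := ℝ)).exists_bound_of_continuous
    (hsource.contDiff.continuous_fderiv (by simp))
  have hN0 : 0 ≤ N := (norm_nonneg _).trans (hN 0)
  refine ⟨N + 1, by linarith, fun τ ε hε hετ a x => ?_⟩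
  have hderiv (e : E3) : fderiv ℝ (localSource τ ε a) x e
      = (ε ^ 4)⁻¹ * fderiv ℝ (yukawaSource μ) (ε⁻¹ • (x - a)) e := by
    change dirDeriv e _ x = (ε ^ 4)⁻¹ * dirDeriv e _ _
    rw [funext (localSource_eq τ hε.ne' a), hετ,
      dirDeriv_const_mul (hsource.differentiable.fun_comp (by fun_prop)),
      dirDeriv_comp_smul_sub hsource.differentiable]
    ring
  rw [gradient, LinearIsometryEquiv.norm_map]
  refine ContinuousLinearMap.opNorm_le_bound _ (by positivity) fun e => ?_
  rw [hderiv, norm_mul, norm_inv, norm_pow, Real.norm_of_nonneg hε.le, div_eq_inv_mul, mul_assoc]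
  gcongr
  exact ((fderiv ℝ (yukawaSource μ) _).le_opNorm e).trans (by gcongr; linarith [hN (ε⁻¹ • (x - a))])

theorem gradient_localSource_of_notMem (τ : ℝ) (hε : 0 < ε) {a x : E3}
    (hx : x ∉ Metric.closedBall a ε) : gradient (localSource τ ε a) x = 0 := by
  have hzero : localSource τ ε a =ᶠ[𝓝 x] fun _ => 0 := by
    filter_upwards [Metric.isClosed_closedBall.isOpen_compl.mem_nhds hx] with y hy
    exact localSource_of_notMem τ hε hy
  rw [gradient, hzero.fderiv_eq]
  simp

variable {f v : E3 → ℝ} {G : E3 → E3}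

theorem IsWeakSolution.integral_mul_localSource (h : IsWeakSolution τ f v G)
    (hf : MemLp f 2 volume) (hτ : 0 < τ) (hε : 0 < ε) (a : E3) :
    ∫ x, v x * localSource τ ε a x = ∫ x, f x * localYukawa τ ε a x :=
  ((isSmoothH2_localYukawa hτ hε a).integral_mul_helmholtz h.memLp τ).trans
    (h.integral_mul_helmholtz hf (isSmoothH2_localYukawa hτ hε a))

theorem IsWeakSolution.integral_grad_mul_localSource (h : IsWeakSolution τ f v G)
    (hf : MemLp f 2 volume) (hτ : 0 < τ) (hε : 0 < ε) (a e : E3) :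
    ∫ x, inner ℝ (G x) e * localSource τ ε a x
      = -∫ x, f x * dirDeriv e (localYukawa τ ε a) x :=
  ((isSmoothH2_localYukawa hτ hε a).integral_mul_helmholtz (h.memLp_grad.inner_const e) τ).trans
    (h.integral_grad_mul_helmholtz hf (isSmoothH2_localYukawa hτ hε a) e)

end LocalYukawa

/-! ### Inner balls at boundary points -/

/-- `S` contains balls which shrink to `x` and whose radii are comparable to the distance of
their centres from `x`. Both the cone condition and a `C¹` boundary provide this. -/
def HasInnerBalls {E : Type*} [NormedAddCommGroup E] [NormedSpace ℝ E] (S : Set E) (x : E) :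
    Prop :=
  ∃ (n : E) (h ρ : ℝ), ‖n‖ ≤ 1 ∧ 0 < h ∧ 0 < ρ ∧ ρ ≤ 1 ∧
    ∀ t, 0 < t → t ≤ h → Metric.closedBall (x + t • n) (t * ρ) ⊆ S

/-- The common weakening of the cone condition and of the `C¹` boundary condition under which the
estimates hold: `S` has inner balls at each of its boundary points. -/
def InnerBallCondition {E : Type*} [NormedAddCommGroup E] [NormedSpace ℝ E] (S : Set E) :
    Prop :=
  ∀ x ∈ frontier S, HasInnerBalls S x

section InnerBalls

variable {E : Type*} [NormedAddCommGroup E] [NormedSpace ℝ E] {S T : Set E} {x n : E}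

theorem closedBall_add_smul_subset {t ρ : ℝ} (hn : ‖n‖ ≤ 1) (ht : 0 ≤ t) (hρ : ρ ≤ 1) :
    Metric.closedBall (x + t • n) (t * ρ) ⊆ Metric.closedBall x (2 * t) := by
  apply Metric.closedBall_subset_closedBall'
  rw [dist_eq_norm, add_sub_cancel_left, norm_smul_of_nonneg ht]
  linarith [mul_le_of_le_one_right ht hρ, mul_le_of_le_one_right ht hn]

theorem HasInnerBalls.of_inter_subset (hS : HasInnerBalls S x) {U : Set E} (hU : U ∈ 𝓝 x)
    (hST : S ∩ U ⊆ T) : HasInnerBalls T x := by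
  obtain ⟨n, h, ρ, hn, hh, hρ, hρ_one, hballs⟩ := hS
  obtain ⟨r, hr, hrU⟩ := Metric.nhds_basis_closedBall.mem_iff.1 hU
  refine ⟨n, min h (r / 2), ρ, hn, by positivity, hρ, hρ_one,
    fun t ht hth y hy => hST ⟨?_, hrU ?_⟩⟩
  · exact hballs t ht (hth.trans (min_le_left _ _)) hy
  · have htr := hth.trans (min_le_right _ _)
    exact Metric.closedBall_subset_closedBall (by linarith)
      (closedBall_add_smul_subset hn ht.le hρ_one hy)

theorem hasInnerBalls_of_mem_interior (hx : x ∈ interior S) : HasInnerBalls S x :=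
  HasInnerBalls.of_inter_subset (S := Set.univ)
    ⟨0, 1, 1, by simp, one_pos, one_pos, le_rfl, fun _ _ _ => Set.subset_univ _⟩
    (mem_interior_iff_mem_nhds.1 hx) Set.inter_subset_right

theorem InnerBallCondition.hasInnerBalls (hS : InnerBallCondition S) (hx : x ∈ closure S) :
    HasInnerBalls S x := by
  rw [closure_eq_interior_union_frontier] at hx
  exact hx.elim hasInnerBalls_of_mem_interior (hS x)

theorem hasInnerBalls_cone (L : E →L[ℝ] ℝ) (c : ℝ) (x : E) (hn : ‖n‖ ≤ 1)
    (hLn : L n + c * ‖n‖ < 0) : HasInnerBalls {y | L (y - x) + c * ‖y - x‖ < 0} x := by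
  set m := -(L n + c * ‖n‖)
  have hm : 0 < m := neg_pos.2 hLn
  set K := ‖L‖ + |c| + 1
  have hK : 0 < K := by positivity
  refine ⟨n, 1, min 1 (m / (2 * K)), hn, one_pos, by positivity, min_le_left _ _,
    fun t ht _ y hy => ?_⟩
  rw [mem_closedBall_iff_norm] at hy
  set u := y - (x + t • n)
  have hyx : y - x = t • n + u := by simp only [u]; abel
  have hu : (‖L‖ + |c|) * ‖u‖ ≤ t * m / 2 :=
    calc (‖L‖ + |c|) * ‖u‖ ≤ K * (t * (m / (2 * K))) := by
          gcongr
          · simp [K]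
          · exact hy.trans (by gcongr; exact min_le_right _ _)
      _ = t * m / 2 := by field_simp
  have hL : L (y - x) ≤ t * L n + ‖L‖ * ‖u‖ := by
    rw [hyx, map_add, map_smul, smul_eq_mul]
    gcongr
    exact (le_abs_self _).trans (L.le_opNorm u)
  have hc : c * ‖y - x‖ ≤ c * (t * ‖n‖) + |c| * ‖u‖ := by
    have hnorm : |‖y - x‖ - t * ‖n‖| ≤ ‖u‖ := by
      simpa [hyx, norm_smul_of_nonneg ht.le] using abs_norm_sub_norm_le (t • n + u) (t • n)
    calc c * ‖y - x‖ = c * (t * ‖n‖) + c * (‖y - x‖ - t * ‖n‖) := by ring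
      _ ≤ c * (t * ‖n‖) + |c| * |‖y - x‖ - t * ‖n‖| := by
          rw [← abs_mul]
          gcongr
          exact le_abs_self _
      _ ≤ _ := by gcongr
  calc L (y - x) + c * ‖y - x‖ ≤ -(t * m) + (‖L‖ + |c|) * ‖u‖ := by
        simp only [m]
        linarith
    _ ≤ -(t * m) + t * m / 2 := by gcongr
    _ < 0 := by linarith [mul_pos ht hm]

theorem hasInnerBalls_of_hasFDerivAt {φ : E → ℝ} {L : E →L[ℝ] ℝ} (hφ : HasFDerivAt φ L x)
    (hφx : φ x ≤ 0) (hL : L ≠ 0) : HasInnerBalls {y | φ y < 0} x := by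
  obtain ⟨n, hn, hLn⟩ : ∃ n, ‖n‖ < 1 ∧ L n < 0 := by
    obtain ⟨w, hw, hLw⟩ := L.exists_lt_apply_of_lt_opNorm (norm_pos_iff.2 hL)
    rcases (norm_pos_iff.1 hLw).lt_or_gt with hneg | hpos
    · exact ⟨w, hw, hneg⟩
    · exact ⟨-w, by rwa [norm_neg], by rwa [map_neg, neg_lt_zero]⟩
  have hcone : L n + -L n * ‖n‖ < 0 := by nlinarith
  refine (hasInnerBalls_cone L (-L n) x hn.le hcone).of_inter_subset
    (hφ.isLittleO.def (neg_pos.2 hLn)) fun y hy => ?_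
  obtain ⟨hy_cone, hy_expansion⟩ := hy
  rw [Set.mem_ofPred_eq] at hy_cone hy_expansion ⊢
  linarith [(le_abs_self _).trans hy_expansion]

end InnerBalls

section MeasureFrontier

variable {E : Type*} [NormedAddCommGroup E] [NormedSpace ℝ E] [FiniteDimensional ℝ E]
  [MeasurableSpace E] [BorelSpace E] {S : Set E}

theorem HasInnerBalls.exists_density_frontier_add_le {x : E} (hS : HasInnerBalls S x)
    (μ : Measure E) [μ.IsAddHaarMeasure] : ∃ c : ENNReal, 0 < c ∧ ∀ᶠ r in 𝓝[>] (0 : ℝ),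
      μ (frontier S ∩ Metric.closedBall x r) / μ (Metric.closedBall x r) + c ≤ 1 := by
  obtain ⟨n, h, ρ, hn, hh, hρ, hρ_one, hballs⟩ := hS
  refine ⟨ENNReal.ofReal ((ρ / 2) ^ Module.finrank ℝ E), ENNReal.ofReal_pos.2 (by positivity), ?_⟩
  filter_upwards [Ioo_mem_nhdsGT hh] with r hr
  have hr0 : 0 < r := hr.1
  set Q := Metric.ball (x + (r / 2) • n) (r / 2 * ρ)
  have hQ_frontier : Disjoint (frontier S) Q := by
    rw [← closure_sdiff_interior]
    refine Set.disjoint_sdiff_left.mono_right (interior_maximal ?_ Metric.isOpen_ball)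
    exact Metric.ball_subset_closedBall.trans (hballs _ (by positivity) (by linarith [hr.2]))
  have hQ_ball : Q ⊆ Metric.closedBall x r := by
    have := closedBall_add_smul_subset (x := x) hn (half_pos hr0).le hρ_one
    rw [mul_div_cancel₀ r two_ne_zero] at this
    exact Metric.ball_subset_closedBall.trans this
  have hQ_measure : μ Q / μ (Metric.closedBall x r)
      = ENNReal.ofReal ((ρ / 2) ^ Module.finrank ℝ E) := by
    rw [Measure.addHaar_ball_of_pos _ _ (by positivity), Measure.addHaar_closedBall _ _ hr0.le,
      ENNReal.mul_div_mul_right _ _ (Metric.measure_ball_pos _ _ one_pos).ne'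
        measure_ball_lt_top.ne, ← ENNReal.ofReal_div_of_pos (by positivity), ← div_pow]
    congr 2
    field_simp
  rw [← hQ_measure, ← ENNReal.add_div]
  refine ENNReal.div_le_of_le_mul ?_
  rw [one_mul, ← measure_union (hQ_frontier.mono_left Set.inter_subset_left)
    Metric.isOpen_ball.measurableSet]
  exact measure_mono (Set.union_subset Set.inter_subset_right hQ_ball)

theorem InnerBallCondition.measure_frontier (hS : InnerBallCondition S) (μ : Measure E)
    [μ.IsAddHaarMeasure] : μ (frontier S) = 0 := by
  rw [measure_eq_zero_iff_ae_notMem]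
  filter_upwards [Besicovitch.ae_tendsto_measure_inter_div_of_measurableSet μ
    (isClosed_frontier (s := S)).measurableSet] with x hx hxS
  rw [Set.indicator_of_mem hxS] at hx
  obtain ⟨c, hc, hle⟩ := (hS x hxS).exists_density_frontier_add_le μ
  have hlim : 1 + c ≤ 1 := le_of_tendsto (hx.add_const c) hle
  exact hlim.not_gt (ENNReal.lt_add_right ENNReal.one_ne_top hc.ne')

end MeasureFrontier

theorem ConeCondition.innerBallCondition {S : Set E3} (hS : ConeCondition S) :
    InnerBallCondition S := by
  intro x hx
  obtain ⟨n, h, θ, hn, hh, hθ, hθπ, hcone⟩ := hS x hx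
  have hcos : Real.cos θ < 1 := by
    simpa using Real.cos_lt_cos_of_nonneg_of_le_pi le_rfl hθπ.le hθ
  refine (hasInnerBalls_cone (-(innerSL ℝ n)) (Real.cos θ) x hn.le ?_).of_inter_subset
    (Metric.closedBall_mem_nhds x hh) fun y hy => hcone ⟨?_, ?_⟩
  · simpa [hn] using hcos
  · have hinner : ‖y - x‖ * Real.cos θ < inner ℝ (y - x) n := by
      simpa [real_inner_comm, mul_comm] using hy.1
    exact ⟨mem_closedBall_iff_norm.1 hy.2, hinner.le⟩
  · rintro rfl
    simpa using hy.1

theorem HasC1Boundary.innerBallCondition {S : Set E3} (hS : HasC1Boundary S) :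
    InnerBallCondition S := by
  intro x hx
  obtain ⟨U, φ, hU, hxU, hφ, hφ', hneg, hpos⟩ := hS x hx
  have hφ_at : ContDiffAt ℝ 1 φ x := hφ.contDiffAt (hU.mem_nhds hxU)
  have hφx : φ x ≤ 0 := by
    have : (𝓝[U ∩ S] x).NeBot := mem_closure_iff_nhdsWithin_neBot.1
      (hU.inter_closure ⟨hxU, frontier_subset_closure hx⟩)
    refine le_of_tendsto (hφ_at.continuousAt.tendsto.mono_left nhdsWithin_le_nhds)
      (x := 𝓝[U ∩ S] x) ?_
    filter_upwards [self_mem_nhdsWithin] with y hy using hpos y hy.1 hy.2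
  exact (hasInnerBalls_of_hasFDerivAt (hφ_at.differentiableAt one_ne_zero).hasFDerivAt hφx
    hφ').of_inter_subset (hU.mem_nhds hxU) fun y hy => hneg y hy.2 hy.1

/-! ### The distance of two sets -/

section SetDist

variable {D B : Set E3}

theorem setDist_le_of_mem {x y : E3} (hx : x ∈ D) (hy : y ∈ B) : setDist D B ≤ ‖x - y‖ := by
  refine csInf_le ⟨0, ?_⟩ ⟨x, hx, y, hy, rfl⟩
  rintro r ⟨x, -, y, -, rfl⟩
  exact norm_nonneg _

theorem setDist_le {x y : E3} (hx : x ∈ closure D) (hy : y ∈ closure B) :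
    setDist D B ≤ ‖x - y‖ := by
  have hclosure {a : E3} (ha : a ∈ D) : setDist D B ≤ ‖a - y‖ :=
    le_on_closure (f := fun _ => setDist D B) (g := fun b => ‖a - b‖)
      (fun b hb => setDist_le_of_mem ha hb) continuousOn_const (by fun_prop) hy
  exact le_on_closure (f := fun _ => setDist D B) (g := fun a => ‖a - y‖)
    (fun a ha => hclosure ha) continuousOn_const (by fun_prop) hx

theorem exists_norm_sub_eq_setDist (hD : Bornology.IsBounded D) (hDne : D.Nonempty)
    (hBne : B.Nonempty) : ∃ p ∈ closure D, ∃ q ∈ closure B, ‖p - q‖ = setDist D B := by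
  obtain ⟨p, hp, hmin⟩ := hD.isCompact_closure.exists_isMinOn hDne.closure
    (Metric.continuous_infDist_pt (closure B)).continuousOn
  obtain ⟨q, hq, hpq⟩ := isClosed_closure.exists_infDist_eq_dist hBne.closure p
  refine ⟨p, hp, q, hq, le_antisymm ?_ (setDist_le hp hq)⟩
  obtain ⟨a, ha⟩ := hDne
  obtain ⟨b, hb⟩ := hBne
  refine le_csInf ⟨_, a, ha, b, hb, rfl⟩ ?_
  rintro r ⟨x, hx, y, hy, rfl⟩
  rw [← dist_eq_norm, ← dist_eq_norm, ← hpq]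
  exact (isMinOn_iff.1 hmin x (subset_closure hx)).trans
    (Metric.infDist_le_dist_of_mem (subset_closure hy))

end SetDist

/-! ### The lower bound -/

section CauchySchwarz

variable {α : Type*} [MeasurableSpace α] {μ : Measure α}

theorem sq_integral_le_measureReal_mul_integral_sq [IsFiniteMeasure μ] {g : α → ℝ}
    (hg : MemLp g 2 μ) : (∫ x, g x ∂μ) ^ 2 ≤ μ.real Set.univ * ∫ x, g x ^ 2 ∂μ := by
  rcases eq_zero_or_neZero μ with rfl | hμ
  · simp
  have hm : 0 < μ.real Set.univ := measureReal_univ_pos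
  have hjensen := even_two.convexOn_pow.map_average_le (continuous_pow 2).continuousOn isClosed_univ
    (Eventually.of_forall fun x => Set.mem_univ (g x)) (hg.integrable one_le_two) hg.integrable_sq
  simp only [average_eq, smul_eq_mul] at hjensen
  calc (∫ x, g x ∂μ) ^ 2
      = μ.real Set.univ ^ 2 * ((μ.real Set.univ)⁻¹ * ∫ x, g x ∂μ) ^ 2 := by field_simp
    _ ≤ μ.real Set.univ ^ 2 * ((μ.real Set.univ)⁻¹ * ∫ x, g x ^ 2 ∂μ) := by gcongr
    _ = μ.real Set.univ * ∫ x, g x ^ 2 ∂μ := by field_simp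

theorem sq_integral_inner_le {F : Type*} [NormedAddCommGroup F] [InnerProductSpace ℝ F]
    {G H : α → F} {s : Set α} {K : ℝ} (hs : MeasurableSet s) (hμs : μ s ≠ ⊤) (hG : MemLp G 2 μ)
    (hHs : ∀ x ∈ s, ‖H x‖ ≤ K) (hH : ∀ x ∉ s, H x = 0) :
    (∫ x, inner ℝ (G x) (H x) ∂μ) ^ 2 ≤ K ^ 2 * (μ.real s * ∫ x in s, ‖G x‖ ^ 2 ∂μ) := by
  have : IsFiniteMeasure (μ.restrict s) := isFiniteMeasure_restrict.2 hμs
  have hGs : MemLp (fun x => ‖G x‖) 2 (μ.restrict s) := hG.norm.restrict s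
  have hle : |∫ x, inner ℝ (G x) (H x) ∂μ| ≤ K * ∫ x in s, ‖G x‖ ∂μ := by
    have hzero : ∀ x ∉ s, inner ℝ (G x) (H x) = 0 := fun x hx => by rw [hH x hx, inner_zero_right]
    rw [← setIntegral_eq_integral_of_forall_compl_eq_zero hzero, ← integral_const_mul,
      ← Real.norm_eq_abs]
    refine norm_integral_le_of_norm_le ((hGs.integrable one_le_two).const_mul K) ?_
    filter_upwards [ae_restrict_mem hs] with x hx
    calc ‖inner ℝ (G x) (H x)‖ ≤ ‖G x‖ * ‖H x‖ := norm_inner_le_norm _ _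
      _ ≤ K * ‖G x‖ := by rw [mul_comm]; gcongr; exact hHs x hx
  calc (∫ x, inner ℝ (G x) (H x) ∂μ) ^ 2 ≤ (K * ∫ x in s, ‖G x‖ ∂μ) ^ 2 := by
        rw [← sq_abs]
        gcongr
    _ = K ^ 2 * (∫ x in s, ‖G x‖ ∂μ) ^ 2 := mul_pow _ _ _
    _ ≤ _ := by
        gcongr
        simpa using sq_integral_le_measureReal_mul_integral_sq hGs

end CauchySchwarz

theorem volume_real_closedBall_E3 (a : E3) {r : ℝ} (hr : 0 ≤ r) :
    volume.real (Metric.closedBall a r) = r ^ 3 * volume.real (Metric.ball (0 : E3) 1) := by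
  rw [Measure.addHaar_real_closedBall _ _ hr, finrank_euclideanSpace_fin]

theorem volume_real_unitBall_pos : 0 < volume.real (Metric.ball (0 : E3) 1) :=
  ENNReal.toReal_pos (Metric.measure_ball_pos _ _ one_pos).ne' measure_ball_lt_top.ne

theorem sq_exp_neg_mul (τ d : ℝ) : Real.exp (-(τ * d)) ^ 2 = Real.exp (-2 * τ * d) := by
  rw [← Real.exp_nat_mul]
  push_cast
  ring_nf

section Emission

variable {B : Set E3} {f φ : E3 → ℝ}

theorem mul_measureReal_le_integral_mul_of_le {s : Set E3} {c m : ℝ} (hf : MemLp f 2 volume)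
    (hf_supp : ∀ᵐ x, x ∉ closure B → f x = 0) (hfB : ∀ᵐ x, x ∈ B → c ≤ f x) (hc : 0 < c)
    (hB : IsOpen B) (hB_null : volume (frontier B) = 0) (hφ : MemLp φ 2 volume)
    (hφ_nonneg : ∀ x, 0 ≤ φ x) (hs : MeasurableSet s) (hs_fin : volume s ≠ ⊤) (hsB : s ⊆ B)
    (hφs : ∀ x ∈ s, m ≤ φ x) : c * m * volume.real s ≤ ∫ x, f x * φ x := by
  refine mul_measureReal_le_integral (hf.integrable_mul hφ) ?_ hs hs_fin ?_
  · filter_upwards [hf_supp, hfB, measure_eq_zero_iff_ae_notMem.1 hB_null] with x h0 hx hxB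
    by_cases hxB' : x ∈ B
    · exact mul_nonneg (hc.le.trans (hx hxB')) (hφ_nonneg x)
    · have hx_closure : x ∉ closure B := fun h => hxB (hB.frontier_eq ▸ ⟨h, hxB'⟩)
      simp [h0 hx_closure]
  · filter_upwards [hfB] with x hx hxs
    exact mul_le_mul_of_nonneg (hx (hsB hxs)) (hφs x hxs) hc.le (hφ_nonneg x)

theorem EmissionCondition.exists_mul_measureReal_le_abs_integral (hf : EmissionCondition B f)
    (hB : IsOpen B) (hB_null : volume (frontier B) = 0) :
    ∃ c : ℝ, 0 < c ∧ ∀ φ : E3 → ℝ, MemLp φ 2 volume → (∀ x, 0 ≤ φ x) →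
      ∀ s ⊆ B, MeasurableSet s → volume s ≠ ⊤ → ∀ m, (∀ x ∈ s, m ≤ φ x) →
        c * m * volume.real s ≤ |∫ x, f x * φ x| := by
  obtain ⟨hf_memLp, hf_supp, c, hc, hfB | hfB⟩ := hf <;>
    refine ⟨c, hc, fun φ hφ hφ_nonneg s hsB hs hs_fin m hφs => ?_⟩
  · exact (mul_measureReal_le_integral_mul_of_le hf_memLp hf_supp hfB hc hB hB_null hφ hφ_nonneg
      hs hs_fin hsB hφs).trans (le_abs_self _)
  · have hle := mul_measureReal_le_integral_mul_of_le hf_memLp.neg (by simpa using hf_supp)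
      hfB hc hB hB_null hφ hφ_nonneg hs hs_fin hsB hφs
    simp only [Pi.neg_apply, neg_mul, integral_neg] at hle
    exact hle.trans (neg_le_abs _)

end Emission

theorem IsWeakSolution.sq_integral_mul_localYukawa_le {τ ε K : ℝ} {f v : E3 → ℝ} {G : E3 → E3}
    {D : Set E3} (h : IsWeakSolution τ f v G) (hf : MemLp f 2 volume)
    (hfD : ∀ᵐ x, x ∈ D → f x = 0) (hτ : 0 < τ) (hε : 0 < ε) {a : E3}
    (ha : Metric.closedBall a ε ⊆ D) (hK : ∀ x, ‖gradient (localSource τ ε a) x‖ ≤ K) :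
    (τ ^ 2 * ∫ x, f x * localYukawa τ ε a x) ^ 2
      ≤ K ^ 2 * (ε ^ 3 * volume.real (Metric.ball (0 : E3) 1) * ∫ x in D, ‖G x‖ ^ 2) := by
  have hsource := isTestFunction_localSource τ hε a
  have hzero : ∫ x, f x * localSource τ ε a x = 0 := by
    refine integral_eq_zero_of_ae ?_
    filter_upwards [hfD] with x hx
    by_cases hxa : x ∈ Metric.closedBall a ε
    · simp [hx (ha hxa)]
    · simp [localSource_of_notMem τ hε hxa]
  have hequation := h.equation _ hsource.contDiff hsource.hasCompactSupport
  rw [hzero, h.integral_mul_localSource hf hτ hε a] at hequation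
  have hG_sq : Integrable fun x => ‖G x‖ ^ 2 := h.memLp_grad.norm.integrable_sq
  calc (τ ^ 2 * ∫ x, f x * localYukawa τ ε a x) ^ 2
      = (∫ x, inner ℝ (G x) (gradient (localSource τ ε a) x)) ^ 2 := by
        rw [eq_neg_of_add_eq_zero_left hequation, neg_sq]
    _ ≤ K ^ 2 * (volume.real (Metric.closedBall a ε)
          * ∫ x in Metric.closedBall a ε, ‖G x‖ ^ 2) :=
        sq_integral_inner_le measurableSet_closedBall measure_closedBall_lt_top.ne h.memLp_grad
          (fun x _ => hK x) fun _ hx => gradient_localSource_of_notMem τ hε hx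
    _ ≤ _ := by
        rw [volume_real_closedBall_E3 a hε.le]
        gcongr
        · exact Eventually.of_forall fun x => sq_nonneg _
        · exact hG_sq.integrableOn

theorem norm_sub_add_smul_le {E : Type*} [NormedAddCommGroup E] [NormedSpace ℝ E] (p q : E)
    {n : E} {t : ℝ} (hn : ‖n‖ ≤ 1) (ht : 0 ≤ t) : ‖q - (p + t • n)‖ ≤ ‖p - q‖ + t := by
  rw [← sub_sub, norm_sub_rev p q]
  refine (norm_sub_le _ _).trans ?_
  gcongr
  rw [norm_smul_of_nonneg ht]
  exact mul_le_of_le_one_right ht hn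

theorem exp_div_le_localYukawa {τ ε d M : ℝ} (hτ : 1 ≤ τ) (hε : 0 < ε) (hM : 0 ≤ M) {a x : E3}
    (hx : ε ≤ ‖x - a‖) (hxd : ‖x - a‖ ≤ d + M / τ) :
    Real.exp (-M) * Real.exp (-(τ * d)) / (d + M) ≤ localYukawa τ ε a x := by
  rw [localYukawa_of_ge τ hε hx, ← Real.exp_add]
  have : 0 < τ := by linarith
  have hexponent : τ * ‖x - a‖ ≤ τ * d + M := by
    calc τ * ‖x - a‖ ≤ τ * (d + M / τ) := by gcongr
      _ = τ * d + M := by field_simp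
  gcongr
  · exact hε.trans_le hx
  · linarith
  · exact hxd.trans (by gcongr; exact div_le_self hM hτ)

theorem EmissionCondition.exists_le_abs_integral_mul_localYukawa {B : Set E3} {f : E3 → ℝ}
    (hf : EmissionCondition B f) (hB : IsOpen B) (hB_null : volume (frontier B) = 0) {q : E3}
    (hq : HasInnerBalls B q) {d h : ℝ} (hd : 0 ≤ d) (hh : 0 ≤ h) :
    ∃ A : ℝ, 0 < A ∧ ∀ τ ε : ℝ, 1 ≤ τ → 0 < ε → ∀ a, Disjoint (Metric.closedBall a ε) B →
      ‖q - a‖ ≤ d + h / τ →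
        A * (Real.exp (-(τ * d)) / τ ^ 3) ≤ |∫ x, f x * localYukawa τ ε a x| := by
  obtain ⟨c, hc, hle⟩ := hf.exists_mul_measureReal_le_abs_integral hB hB_null
  obtain ⟨n, t, ρ, hn, ht, hρ, hρ_one, hballs⟩ := hq
  have hV := volume_real_unitBall_pos
  set M := h + 2 * t
  refine ⟨c * (Real.exp (-M) / (d + M)) * ((t * ρ) ^ 3 * volume.real (Metric.ball (0 : E3) 1)),
    by positivity, fun τ ε hτ hε a ha hqa => ?_⟩
  have hτ_pos : 0 < τ := by linarith
  have hball_subset : Metric.closedBall (q + (t / τ) • n) (t / τ * ρ) ⊆ B :=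
    hballs (t / τ) (by positivity) (div_le_self ht.le hτ)
  have hlower : ∀ x ∈ Metric.closedBall (q + (t / τ) • n) (t / τ * ρ),
      Real.exp (-M) * Real.exp (-(τ * d)) / (d + M) ≤ localYukawa τ ε a x := by
    intro x hx
    have hxa : x ∉ Metric.closedBall a ε := Set.disjoint_right.1 ha (hball_subset hx)
    have hxq : ‖x - q‖ ≤ 2 * (t / τ) := mem_closedBall_iff_norm.1
      (closedBall_add_smul_subset hn (by positivity) hρ_one hx)
    rw [mem_closedBall_iff_norm, not_le] at hxa
    refine exp_div_le_localYukawa hτ hε (by positivity) hxa.le ?_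
    calc ‖x - a‖ ≤ ‖x - q‖ + ‖q - a‖ := norm_sub_le_norm_sub_add_norm_sub ..
      _ ≤ 2 * (t / τ) + (d + h / τ) := by gcongr
      _ = d + M / τ := by ring
  refine le_of_eq_of_le ?_ (hle _ (isSmoothH2_localYukawa hτ_pos hε a).memLp
    (localYukawa_nonneg τ hε a) _ hball_subset measurableSet_closedBall
    measure_closedBall_lt_top.ne _ hlower)
  rw [volume_real_closedBall_E3 _ (by positivity)]
  field_simp

theorem EmissionCondition.exists_le_setIntegral_norm_grad_sq {D B : Set E3} {f : E3 → ℝ}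
    (hf : EmissionCondition B f) (hB : IsOpen B) (hB_null : volume (frontier B) = 0)
    (hDB : Disjoint (closure B) (closure D)) {p q : E3} (hp : HasInnerBalls D p)
    (hq : HasInnerBalls B q) :
    ∃ c : ℝ, 0 < c ∧ ∀ τ : ℝ, 1 ≤ τ → ∀ (v : E3 → ℝ) (G : E3 → E3), IsWeakSolution τ f v G →
      c * τ ^ (-7 : ℤ) * Real.exp (-2 * τ * ‖p - q‖) ≤ ∫ x in D, ‖G x‖ ^ 2 := by
  obtain ⟨n, h, ρ, hn, hh, hρ, -, hballs⟩ := hp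
  obtain ⟨A, hA, hA_le⟩ := hf.exists_le_abs_integral_mul_localYukawa hB hB_null hq
    (norm_nonneg (p - q)) hh.le
  obtain ⟨N, hN, hN_le⟩ := exists_bound_gradient_localSource (h * ρ)
  have hV := volume_real_unitBall_pos
  refine ⟨(h * ρ) ^ 5 * A ^ 2 / (N ^ 2 * volume.real (Metric.ball (0 : E3) 1)), by positivity,
    fun τ hτ v G hsol => ?_⟩
  have hτ_pos : 0 < τ := by linarith
  set ε := h / τ * ρ with hε_def
  have hε : 0 < ε := by positivity
  have hball_subset : Metric.closedBall (p + (h / τ) • n) ε ⊆ D :=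
    hballs (h / τ) (by positivity) (div_le_self hh.le hτ)
  have hDB' : Disjoint D B := (hDB.mono subset_closure subset_closure).symm
  have hfD : ∀ᵐ x, x ∈ D → f x = 0 := hf.2.1.mono fun x hx hxD =>
    hx (Set.disjoint_right.1 hDB (subset_closure hxD))
  have hemission := hA_le τ ε hτ hε _ (hDB'.mono_left hball_subset)
    (norm_sub_add_smul_le p q hn (by positivity))
  have henergy := hsol.sq_integral_mul_localYukawa_le hf.1 hfD hτ_pos hε hball_subset
    (hN_le τ ε hε (by rw [hε_def]; field_simp) _)
  rw [mul_pow, ← sq_abs (∫ x, f x * localYukawa τ ε (p + (h / τ) • n) x)] at henergy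
  rw [← sq_exp_neg_mul, zpow_neg]
  norm_cast
  calc (h * ρ) ^ 5 * A ^ 2 / (N ^ 2 * volume.real (Metric.ball (0 : E3) 1)) * (τ ^ 7)⁻¹
        * Real.exp (-(τ * ‖p - q‖)) ^ 2
      = (τ ^ 2) ^ 2 * (A * (Real.exp (-(τ * ‖p - q‖)) / τ ^ 3)) ^ 2
          / ((N / ε ^ 4) ^ 2 * (ε ^ 3 * volume.real (Metric.ball (0 : E3) 1))) := by
        rw [hε_def]
        field_simp
    _ ≤ ∫ x in D, ‖G x‖ ^ 2 := by
        rw [div_le_iff₀' (by positivity), mul_assoc]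
        refine le_trans ?_ henergy
        gcongr

/-! ### The upper bound -/

section LocalAverages

variable {α : Type*} [MeasurableSpace α] {μ : Measure α}

theorem integral_mul_le_integral_sq_add {f g : α → ℝ} (hf : MemLp f 2 μ) (hg : MemLp g 2 μ) :
    ∫ x, f x * g x ∂μ ≤ (∫ x, f x ^ 2 ∂μ) + ∫ x, g x ^ 2 ∂μ := by
  rw [← integral_add hf.integrable_sq hg.integrable_sq]
  refine integral_mono (hf.integrable_mul hg) (hf.integrable_sq.add hg.integrable_sq) fun x => ?_
  change f x * g x ≤ f x ^ 2 + g x ^ 2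
  nlinarith [two_mul_le_add_sq (f x) (g x), sq_nonneg (f x), sq_nonneg (g x)]

theorem abs_integral_inner_mul_sub_le {F : Type*} [NormedAddCommGroup F] [InnerProductSpace ℝ F]
    {G : α → F} {ψ : α → ℝ} {s : Set α} {K : ℝ} (hμs : μ s ≠ ⊤) (hG : IntegrableOn G s μ)
    (hψ : Integrable ψ μ) (hψ_le : ∀ x, |ψ x| ≤ K) (hψ_zero : ∀ x ∉ s, ψ x = 0) (e : F) :
    |(∫ x, inner ℝ (G x) e * ψ x ∂μ) - ‖e‖ ^ 2 * ∫ x, ψ x ∂μ|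
      ≤ K * ‖e‖ * ∫ x in s, ‖G x - e‖ ∂μ := by
  have : IsFiniteMeasure (μ.restrict s) := isFiniteMeasure_restrict.2 hμs
  have hGψ : IntegrableOn (fun x => inner ℝ (G x) e * ψ x) s μ :=
    (hG.inner_const e).mul_bdd hψ.integrableOn.aestronglyMeasurable (Eventually.of_forall hψ_le)
  have hzero : ∀ x ∉ s, inner ℝ (G x) e * ψ x = 0 := fun x hx => by rw [hψ_zero x hx, mul_zero]
  rw [← setIntegral_eq_integral_of_forall_compl_eq_zero hzero,
    ← setIntegral_eq_integral_of_forall_compl_eq_zero hψ_zero, ← integral_const_mul,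
    ← integral_sub hGψ (hψ.integrableOn.const_mul _), ← integral_const_mul, ← Real.norm_eq_abs]
  refine norm_integral_le_of_norm_le ((hG.sub (integrable_const e)).norm.const_mul _)
    (Eventually.of_forall fun x => ?_)
  calc ‖inner ℝ (G x) e * ψ x - ‖e‖ ^ 2 * ψ x‖ = |inner ℝ (G x - e) e| * |ψ x| := by
        rw [← sub_mul, ← real_inner_self_eq_norm_sq, ← inner_sub_left, norm_mul, Real.norm_eq_abs,
          Real.norm_eq_abs]
    _ ≤ ‖G x - e‖ * ‖e‖ * K := by
        gcongr
        · exact abs_real_inner_le_norm _ _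
        · exact hψ_le x
    _ = K * ‖e‖ * ‖G x - e‖ := by ring

end LocalAverages

theorem exp_neg_mul_mul_le {d r τ : ℝ} (hd : 0 < d) (hdr : d ≤ r) (hτ : 1 ≤ τ) :
    Real.exp (-(τ * r)) * (τ / r + 1 / r ^ 2)
      ≤ τ * Real.exp (-(τ * d)) * ((1 / d + 1 / d ^ 2) * Real.exp d) * Real.exp (-r) := by
  have hexp : Real.exp (-(τ * r)) ≤ Real.exp (-(τ * d)) * (Real.exp d * Real.exp (-r)) := by
    rw [← Real.exp_add, ← Real.exp_add, Real.exp_le_exp]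
    nlinarith
  have hpow : τ / r + 1 / r ^ 2 ≤ τ * (1 / d + 1 / d ^ 2) :=
    calc τ / r + 1 / r ^ 2 ≤ τ / d + 1 / d ^ 2 := by gcongr
      _ ≤ τ / d + τ * (1 / d ^ 2) := by
          gcongr
          exact le_mul_of_one_le_left (by positivity) hτ
      _ = τ * (1 / d + 1 / d ^ 2) := by ring
  have hr : 0 < r := hd.trans_le hdr
  calc Real.exp (-(τ * r)) * (τ / r + 1 / r ^ 2)
      ≤ Real.exp (-(τ * d)) * (Real.exp d * Real.exp (-r)) * (τ * (1 / d + 1 / d ^ 2)) := by gcongr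
    _ = _ := by ring

theorem exists_abs_integral_mul_dirDeriv_localYukawa_le {f : E3 → ℝ} (hf : MemLp f 2 volume)
    {d : ℝ} (hd : 0 < d) : ∃ R : ℝ, 0 ≤ R ∧ ∀ τ ε : ℝ, 1 ≤ τ → 0 < ε → ε < d →
      ∀ a e, (∀ᵐ x, f x ≠ 0 → d ≤ ‖x - a‖) →
        |∫ x, f x * dirDeriv e (localYukawa τ ε a) x|
          ≤ R * (τ * Real.exp (-(τ * d))) * ‖e‖ := by
  set K := (1 / d + 1 / d ^ 2) * Real.exp d
  have hK : 0 ≤ K := by positivity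
  refine ⟨K * ((∫ x, f x ^ 2) + ∫ x : E3, Real.exp (-‖x‖) ^ 2),
    mul_nonneg hK (by positivity), fun τ ε hτ hε hεd a e ha => ?_⟩
  have hτ_pos : 0 < τ := by linarith
  have hexp_zero : MemLp (fun x : E3 => Real.exp (-‖x‖)) 2 volume :=
    memLp_two_of_isBigO_exp_neg_mul_norm (by fun_prop) one_pos
      (by simpa only [one_mul] using Asymptotics.isBigO_refl _ _)
  have hexp : MemLp (fun x => Real.exp (-‖x - a‖)) 2 volume :=
    hexp_zero.comp_measurePreserving (measurePreserving_sub_right volume a)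
  have hpointwise : ∀ᵐ x, ‖f x * dirDeriv e (localYukawa τ ε a) x‖
      ≤ τ * Real.exp (-(τ * d)) * K * ‖e‖ * (|f x| * Real.exp (-‖x - a‖)) := by
    filter_upwards [ha] with x hx
    rcases eq_or_ne (f x) 0 with hfx | hfx
    · simp [hfx]
    have hderiv : |dirDeriv e (localYukawa τ ε a) x|
        ≤ τ * Real.exp (-(τ * d)) * K * Real.exp (-‖x - a‖) * ‖e‖ :=
      (abs_dirDeriv_localYukawa_le hτ_pos hε (hεd.trans_le (hx hfx)) e).trans
        (mul_le_mul_of_nonneg_right (exp_neg_mul_mul_le hd (hx hfx) hτ) (norm_nonneg e))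
    rw [norm_mul, Real.norm_eq_abs, Real.norm_eq_abs]
    exact (mul_le_mul_of_nonneg_left hderiv (abs_nonneg _)).trans_eq (by ring)
  have hL2 : ∫ x, |f x| * Real.exp (-‖x - a‖)
      ≤ (∫ x, f x ^ 2) + ∫ x : E3, Real.exp (-‖x‖) ^ 2 := by
    rw [← integral_sub_right_eq_self (fun x : E3 => Real.exp (-‖x‖) ^ 2) a]
    simpa only [Pi.abs_apply, sq_abs] using integral_mul_le_integral_sq_add hf.abs hexp
  calc |∫ x, f x * dirDeriv e (localYukawa τ ε a) x|
      ≤ ∫ x, τ * Real.exp (-(τ * d)) * K * ‖e‖ * (|f x| * Real.exp (-‖x - a‖)) :=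
        norm_integral_le_of_norm_le ((hf.abs.integrable_mul hexp).const_mul _) hpointwise
    _ ≤ τ * Real.exp (-(τ * d)) * K * ‖e‖
          * ((∫ x, f x ^ 2) + ∫ x : E3, Real.exp (-‖x‖) ^ 2) := by
        rw [integral_const_mul]
        gcongr
    _ = _ := by ring

theorem IsWeakSolution.mul_norm_sq_le_of_average {τ ε κ C R : ℝ} {f v : E3 → ℝ} {G : E3 → E3}
    (h : IsWeakSolution τ f v G) (hf : MemLp f 2 volume) (hτ : 0 < τ) (hε : 0 < ε) {a : E3}
    (hκ : κ ≤ ∫ x, localSource τ ε a x) (hC : ∀ x, |localSource τ ε a x| ≤ C / ε ^ 3)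
    (hR : |∫ x, f x * dirDeriv (G a) (localYukawa τ ε a) x| ≤ R * ‖G a‖) :
    κ * ‖G a‖ ^ 2 ≤ (R + C * volume.real (Metric.ball (0 : E3) 1)
      * ⨍ y in Metric.closedBall a ε, ‖G y - G a‖) * ‖G a‖ := by
  have hV := volume_real_unitBall_pos
  have hs : volume (Metric.closedBall a ε) ≠ ⊤ := measure_closedBall_lt_top.ne
  have : IsFiniteMeasure (volume.restrict (Metric.closedBall a ε)) := isFiniteMeasure_restrict.2 hs
  have hsource := isTestFunction_localSource τ hε a
  have herror := abs_integral_inner_mul_sub_le hs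
    ((h.memLp_grad.restrict _).integrable one_le_two)
    (memLp_one_iff_integrable.1 (hsource.memLp 1 volume)) hC
    (fun x hx => localSource_of_notMem τ hε hx) (G a)
  rw [h.integral_grad_mul_localSource hf hτ hε a (G a)] at herror
  have haverage : C / ε ^ 3 * ‖G a‖ * ∫ y in Metric.closedBall a ε, ‖G y - G a‖
      = C * volume.real (Metric.ball (0 : E3) 1)
        * (⨍ y in Metric.closedBall a ε, ‖G y - G a‖) * ‖G a‖ := by
    rw [setAverage_eq, volume_real_closedBall_E3 a hε.le, smul_eq_mul]
    field_simp
  rw [haverage] at herror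
  have hκG : κ * ‖G a‖ ^ 2 ≤ ‖G a‖ ^ 2 * ∫ x, localSource τ ε a x := by
    rw [mul_comm]
    gcongr
  linarith [(abs_le.1 herror).1, (abs_le.1 hR).1]

theorem exists_ae_norm_grad_le {f : E3 → ℝ} (hf : MemLp f 2 volume) {T : Set E3} {d : ℝ}
    (hd : 0 < d) (hfT : ∀ a ∈ T, ∀ᵐ x, f x ≠ 0 → d ≤ ‖x - a‖) :
    ∃ M : ℝ, ∀ τ : ℝ, 1 ≤ τ → ∀ (v : E3 → ℝ) (G : E3 → E3), IsWeakSolution τ f v G →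
      ∀ᵐ a, a ∈ T → ‖G a‖ ≤ M * (τ * Real.exp (-(τ * d))) := by
  obtain ⟨C, hC⟩ := exists_bound_localSource
  obtain ⟨κ, hκ, hκ_le⟩ := exists_integral_localSource_ge
  obtain ⟨R, hR, hR_le⟩ := exists_abs_integral_mul_dirDeriv_localYukawa_le hf hd
  refine ⟨R / κ, fun τ hτ v G h => ?_⟩
  have hτ_pos : 0 < τ := by linarith
  filter_upwards [IsUnifLocDoublingMeasure.ae_tendsto_average_norm_sub volume
    (h.memLp_grad.locallyIntegrable one_le_two) 1] with a hlebesgue haT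
  have haverage : Tendsto (fun ε : ℝ => ⨍ y in Metric.closedBall a ε, ‖G y - G a‖)
      (𝓝[>] 0) (𝓝 0) := by
    refine hlebesgue (fun _ => a) (fun ε => ε) tendsto_id ?_
    filter_upwards [self_mem_nhdsWithin] with ε hε
    exact Metric.mem_closedBall_self (by rw [one_mul]; exact le_of_lt hε)
  have hnear : ∀ᶠ ε : ℝ in 𝓝[>] 0, κ * ‖G a‖ ^ 2
      ≤ (R * (τ * Real.exp (-(τ * d))) + C * volume.real (Metric.ball (0 : E3) 1)
        * ⨍ y in Metric.closedBall a ε, ‖G y - G a‖) * ‖G a‖ := by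
    filter_upwards [Ioo_mem_nhdsGT (lt_min hd (inv_pos.2 hτ_pos))] with ε ⟨hε, hε_lt⟩
    have hετ : ε * τ ≤ 1 := by
      rw [← le_div_iff₀ hτ_pos, one_div]
      exact (hε_lt.trans_le (min_le_right _ _)).le
    exact h.mul_norm_sq_le_of_average hf hτ_pos hε (hκ_le τ ε hτ_pos hε hετ a)
      (hC τ ε hτ_pos hε hετ a)
      (hR_le τ ε hτ hε (hε_lt.trans_le (min_le_left _ _)) a (G a) (hfT a haT))
  have hlimit := ge_of_tendsto (((haverage.const_mul _).const_add _).mul_const _) hnear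
  rw [mul_zero, add_zero] at hlimit
  rcases (norm_nonneg (G a)).eq_or_lt with hGa | hGa
  · rw [← hGa]
    positivity
  · rw [div_mul_eq_mul_div, le_div_iff₀' hκ]
    exact le_of_mul_le_mul_right (by linarith) hGa

theorem exists_setIntegral_norm_grad_sq_le {f : E3 → ℝ} (hf : MemLp f 2 volume) {D : Set E3}
    (hD : Bornology.IsBounded D) {d : ℝ} (hd : 0 < d)
    (hfD : ∀ a ∈ closure D, ∀ᵐ x, f x ≠ 0 → d ≤ ‖x - a‖) :
    ∃ M : ℝ, 0 < M ∧ ∀ τ : ℝ, 1 ≤ τ → ∀ (v : E3 → ℝ) (G : E3 → E3), IsWeakSolution τ f v G →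
      ∫ x in D, ‖G x‖ ^ 2 ≤ M * τ ^ 2 * Real.exp (-2 * τ * d) := by
  obtain ⟨M, hM⟩ := exists_ae_norm_grad_le hf hd hfD
  refine ⟨volume.real (closure D) * M ^ 2 + 1, by positivity, fun τ hτ v G h => ?_⟩
  have hG_sq : Integrable fun x => ‖G x‖ ^ 2 := h.memLp_grad.norm.integrable_sq
  rw [← sq_exp_neg_mul]
  calc ∫ x in D, ‖G x‖ ^ 2 ≤ ∫ x in closure D, ‖G x‖ ^ 2 :=
        setIntegral_mono_set hG_sq.integrableOn (Eventually.of_forall fun x => sq_nonneg _)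
          subset_closure.eventuallyLE
    _ ≤ ∫ _ in closure D, (M * (τ * Real.exp (-(τ * d)))) ^ 2 := by
        refine setIntegral_mono_on_ae hG_sq.integrableOn
          (integrableOn_const hD.isCompact_closure.measure_lt_top.ne)
          isClosed_closure.measurableSet ?_
        filter_upwards [hM τ hτ v G h] with x hx hxD
        gcongr
        exact hx hxD
    _ = volume.real (closure D) * M ^ 2 * (τ ^ 2 * Real.exp (-(τ * d)) ^ 2) := by
        rw [setIntegral_const, smul_eq_mul]
        ring
    _ ≤ (volume.real (closure D) * M ^ 2 + 1) * (τ ^ 2 * Real.exp (-(τ * d)) ^ 2) := by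
        gcongr
        linarith
    _ = _ := (mul_assoc _ _ _).symm

theorem mainTheorem3_general (D B : Set E3) (f : E3 → ℝ)
    (hD : Bornology.IsBounded D) (hDne : D.Nonempty)
    (hB : IsOpen B) (hBne : B.Nonempty)
    (hDB : Disjoint (closure B) (closure D))
    (hf : EmissionCondition B f)
    (hD_balls : InnerBallCondition D) (hB_balls : InnerBallCondition B) :
    ∃ C : ℝ, 0 < C ∧ ∀ τ : ℝ, 1 ≤ τ →
      (∃ (v : E3 → ℝ) (G : E3 → E3), IsWeakSolution τ f v G) ∧
      ∀ (v : E3 → ℝ) (G : E3 → E3), IsWeakSolution τ f v G →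
        C⁻¹ * τ ^ (-7 : ℤ) * Real.exp (-2 * τ * setDist D B) ≤ ∫ x in D, ‖G x‖ ^ 2 ∧
        ∫ x in D, ‖G x‖ ^ 2 ≤ C * τ ^ 2 * Real.exp (-2 * τ * setDist D B) := by
  obtain ⟨p, hp, q, hq, hpq⟩ := exists_norm_sub_eq_setDist hD hDne hBne
  have hdist : 0 < setDist D B :=
    hpq ▸ norm_sub_pos_iff.2 fun h => Set.disjoint_left.1 hDB hq (h ▸ hp)
  have hfar : ∀ a ∈ closure D, ∀ᵐ x, f x ≠ 0 → setDist D B ≤ ‖x - a‖ := fun a ha =>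
    hf.2.1.mono fun x hx hfx => norm_sub_rev a x ▸ setDist_le ha (not_imp_comm.1 hx hfx)
  obtain ⟨c, hc, hlower⟩ := hf.exists_le_setIntegral_norm_grad_sq hB
    (hB_balls.measure_frontier volume) hDB (hD_balls.hasInnerBalls hp)
    (hB_balls.hasInnerBalls hq)
  obtain ⟨M, hM, hupper⟩ := exists_setIntegral_norm_grad_sq_le hf.1 hD hdist hfar
  refine ⟨max M c⁻¹, lt_max_of_lt_left hM, fun τ hτ =>
    ⟨exists_isWeakSolution (by positivity) hf.1, fun v G h => ⟨?_, ?_⟩⟩⟩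
  · refine le_trans ?_ (hpq ▸ hlower τ hτ v G h)
    gcongr
    exact inv_le_of_inv_le₀ hc (le_max_right _ _)
  · refine (hupper τ hτ v G h).trans ?_
    gcongr
    exact le_max_left _ _

theorem mainTheorem3 (D B : Set E3) (f : E3 → ℝ)
    (hD : Bornology.IsBounded D) (hDne : D.Nonempty)
    (hB : IsOpen B) (hBne : B.Nonempty)
    (hDB : Disjoint (closure B) (closure D))
    (hf : EmissionCondition B f)
    (hab : (HasC1Boundary D ∧ ConeCondition B) ∨
      (ConeCondition D ∧ ConeCondition B ∧ Convex ℝ B)) :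
    ∃ C : ℝ, 0 < C ∧ ∀ τ : ℝ, 1 ≤ τ →
      (∃ (v : E3 → ℝ) (G : E3 → E3), IsWeakSolution τ f v G) ∧
      ∀ (v : E3 → ℝ) (G : E3 → E3), IsWeakSolution τ f v G →
        C⁻¹ * τ ^ (-7 : ℤ) * Real.exp (-2 * τ * setDist D B) ≤ ∫ x in D, ‖G x‖ ^ 2 ∧
        ∫ x in D, ‖G x‖ ^ 2 ≤ C * τ ^ 2 * Real.exp (-2 * τ * setDist D B) := by
  exact mainTheorem3_general D B f hD hDne hB hBne hDB hf
    (hab.elim (·.1.innerBallCondition) (·.1.innerBallCondition))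
    (hab.elim (·.2.innerBallCondition) (·.2.1.innerBallCondition))
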